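/- **Setting.** Let $\mathcal I$ be a finite non-empty set of nodes of a directed acyclic graph, let $\pi_i\subseteq\mathcal I$ be the parents of $i$, and let $m=\sum_{i\in\mathcal I}2^{|\pi_i|}$ be the number of pairs $(i,j)$ with $i\in\mathcal I$, $j\in\{0,1\}^{\pi_i}$. For a data set $D=(x^1,\dots,x^n)$ of $n\ge 1$ records $x^t\in\{0,1\}^{\mathcal I}$ put $$\Delta\alpha_{i,j}=\#\{t: x^t_{\pi_i}=j,\ x^t_i=1\},\qquad \Delta\beta_{i,j}=\#\{t: x^t_{\pi_i}=j,\ x^t_i=0\}.$$ The priors are $\mathrm{Beta}(\alpha_{i,j},\beta_{i,j})$ with $\alpha_{i,j},\beta_{i,j}\ge 2$. The posterior is $\xi(\cdot\mid D)=\bigotimes_{i,j}\mathrm{Beta}(\alpha_{i,j}+\Delta\alpha_{i,j},\beta_{i,j}+\Delta\beta_{i,j})$. Given $\epsilon>0$, put $b=2|\mathcal I|/\epsilon$. Algorithm 1 adds zero-mean Laplace noise of scale $b$ to each $\Delta\alpha_{i,j}$ and each $\Delta\beta_{i,j}$, truncates each result to $[0,n]$ (values below $0$ become $0$, values above $n$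 become $n$), and outputs the truncated pairs $Z_{i,j}=(Z^{(1)}_{i,j},Z^{(2)}_{i,j})\in[0,n]^2$; assume that the $Z_{i,j}$ are independent. For $z\in([0,n]^2)^m$ let $\xi'_z=\bigotimes_{i,j}\mathrm{Beta}(\alpha_{i,j}+z^{(1)}_{i,j},\beta_{i,j}+z^{(2)}_{i,j})$; the privatised posterior is $\xi'_Z$. Let $$f_{i,j}(z_{i,j})=D_{KL}\big(\mathrm{Beta}(\alpha_{i,j}+\Delta\alpha_{i,j},\beta_{i,j}+\Delta\beta_{i,j})\,\big\|\,\mathrm{Beta}(\alpha_{i,j}+z^{(1)}_{i,j},\beta_{i,j}+z^{(2)}_{i,j})\big),\qquad f(z)=\sum_{i,j}f_{i,j}(z_{i,j}).$$ **Theorem.** (a) For all $z\in([0,n]^2)^m$, $D_{KL}(\xi(\cdot\mid D)\,\|\,\xi'_z)=f(z)$. (b) If $c_{i,j}$ are real numbers with $|f_{i,j}(z)-f_{i,j}(z')|\le c_{i,j}$ for all $z,z'\in[0,n]^2$, then for all $0<\delta\le 1$ $$\Pr\Big[f(Z)\ge \mathbb E f(Z)+\Big(-\tfrac12\sum_{i,j}c_{i,j}^2\ln\delta\Big)^{1/2}\Big]\le\delta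 .$$ This condition on $c_{i,j}$ holds for $c_{i,j}=(2n+1)\ln[(\alpha_{i,j}+n+1)+(\beta_{i,j}+n+1)]$. (c) Each $f_{i,j}(Z_{i,j})$ is integrable, and $\mathbb E f_{i,j}(Z_{i,j})\le n\ln\big((\alpha_{i,j}+\Delta\alpha_{i,j})(\beta_{i,j}+\Delta\beta_{i,j})\big)$. (d) If moreover $n\ge b$, then $$\mathbb E f_{i,j}(Z_{i,j})\le n\ln[(\alpha_{i,j}+n+1)(\beta_{i,j}+n+1)]\Big[1-\exp\Big(-\frac{n\epsilon}{2|\mathcal I|}\Big)\Big].$$ (e) For all real $A$ and $s$ there is a constant $C>0$, depending on $A$ and $s$ only, such that in the above setting, if $n\ge 2$, all $\alpha_{i,j},\beta_{i,j}\in[2,A]$ and $b\le\max(n,s)$, then for all $0<\delta\le 1$, with probability at least $1-\delta$, $$D_{KL}\big(\xi(\cdot\mid D)\,\big\|\,\xi'_Z\big)\le C\,mn\ln n\Big[1-\exp\Big(-\frac{n\epsilon}{2|\mathcal I|}\Big)\Big]+\sqrt{-C\,mn\ln n\,\ln\delta}.$$ (With $s=0$: the constant depends on $A$ only as long as $n\ge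 b$. With $s=b$: for fixed $|\mathcal I|$ and $\epsilon$ the bound holds for all $n\ge 2$.) -/

import Mathlib

open MeasureTheory ProbabilityTheory InformationTheory

/-- The directed acyclic graph of a Bayesian network on the index set `I`. -/
structure BayesNet (I : Type*) where
  /-- the parents `π_i` of the node `i` -/
  parents : I → Finset I
  acyclic : ∀ i, ¬ Relation.TransGen (fun j k => j ∈ parents k) i i

namespace BayesNet

variable {I : Type*} (G : BayesNet I)

/-- The pairs `(i, j)` of a node `i` and a value `j ∈ {0,1}^{π_i}` of its parents. -/
abbrev Cell : Type _ := Σ i : I, ({k // k ∈ G.parents i} → Bool)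

/-- `m = ∑ i, 2 ^ |π_i|`. -/
def size [Fintype I] : ℕ := ∑ i, 2 ^ (G.parents i).card

/-- `Δα_{i,j}`: the number of records with `x_i = 1` and `x_{π_i} = j`. -/
def updateA {n : ℕ} (D : Fin n → I → Bool) (c : G.Cell) : ℕ :=
  (Finset.univ.filter fun t : Fin n => (∀ k, D t k.1 = c.2 k) ∧ D t c.1 = true).card

/-- `Δβ_{i,j}`: the number of records with `x_i = 0` and `x_{π_i} = j`. -/
def updateB {n : ℕ} (D : Fin n → I → Bool) (c : G.Cell) : ℕ :=
  (Finset.univ.filter fun t : Fin n => (∀ k, D t k.1 = c.2 k) ∧ D t c.1 = false).card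

/-- The posterior of `θ_{i,j}` given the data, from the prior `Beta(α_{i,j}, β_{i,j})`. -/
noncomputable def cellPosterior (α β : G.Cell → ℝ) {n : ℕ} (D : Fin n → I → Bool) (c : G.Cell) :
    Measure ℝ :=
  betaMeasure (α c + G.updateA D c) (β c + G.updateB D c)

/-- The Beta distribution of `θ_{i,j}` when the released updates of this cell are `z`. -/
noncomputable def cellPrivate (α β : G.Cell → ℝ) (c : G.Cell) (z : ℝ × ℝ) : Measure ℝ :=
  betaMeasure (α c + z.1) (β c + z.2)

/-- `f_{i,j}(z)`: the divergence from the posterior to the private posterior in one cell. -/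
noncomputable def cellLoss (α β : G.Cell → ℝ) {n : ℕ} (D : Fin n → I → Bool) (c : G.Cell)
    (z : ℝ × ℝ) : ℝ :=
  (klDiv (G.cellPosterior α β D c) (G.cellPrivate α β c z)).toReal

variable [Fintype I] [DecidableEq I]

/-- `f(z) = ∑_{i,j} f_{i,j}(z_{i,j})`. -/
noncomputable def sumLoss (α β : G.Cell → ℝ) {n : ℕ} (D : Fin n → I → Bool)
    (z : G.Cell → ℝ × ℝ) : ℝ :=
  ∑ c, G.cellLoss α β D c (z c)

/-- The joint product posterior. -/
noncomputable def posterior (α β : G.Cell → ℝ) {n : ℕ} (D : Fin n → I → Bool) :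
    Measure (G.Cell → ℝ) :=
  Measure.pi fun c => G.cellPosterior α β D c

/-- The joint product private posterior parametrised by released updates `z`. -/
noncomputable def privatePosterior (α β : G.Cell → ℝ) (z : G.Cell → ℝ × ℝ) :
    Measure (G.Cell → ℝ) :=
  Measure.pi fun c => G.cellPrivate α β c (z c)

end BayesNet

/-- The zero-mean Laplace distribution with scale `b > 0`. -/
noncomputable def laplaceMeasure (b : ℝ) : Measure ℝ :=
  volume.withDensity fun x => ENNReal.ofReal (1 / (2 * b) * Real.exp (-|x| / b))

namespace BayesNet

variable {I : Type*} (G : BayesNet I)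

/-- The output of the mechanism with noise `N₁`, `N₂`: in each cell both counts are perturbed
and then truncated to `[0, n]`, from below at `0` and from above at `n`. -/
noncomputable def release {n : ℕ} (D : Fin n → I → Bool) {Ω : Type*} (N₁ N₂ : G.Cell → Ω → ℝ)
    (c : G.Cell) (ω : Ω) : ℝ × ℝ :=
  (max 0 (min (G.updateA D c + N₁ c ω) n), max 0 (min (G.updateB D c + N₂ c ω) n))

/-- `N₁`, `N₂` is the noise of a run of the mechanism: every noise variable is Laplace of scale
`2 |I| / ε`, and the released pairs `Z_{i,j}` are independent of each other. (Mutual independence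
of all the noise variables implies the latter.) -/
structure IsRun [Fintype I] {n : ℕ} (D : Fin n → I → Bool) (ε : ℝ) {Ω : Type*}
    [MeasurableSpace Ω] (P : Measure Ω) (N₁ N₂ : G.Cell → Ω → ℝ) : Prop where
  measurable₁ : ∀ c, Measurable (N₁ c)
  measurable₂ : ∀ c, Measurable (N₂ c)
  law₁ : ∀ c, P.map (N₁ c) = laplaceMeasure (2 * Fintype.card I / ε)
  law₂ : ∀ c, P.map (N₂ c) = laplaceMeasure (2 * Fintype.card I / ε)
  indep : iIndepFun (fun c => G.release D N₁ N₂ c) P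

end BayesNet

/-! ### The logarithm of the Gamma function and its derivative -/

/-! The Beta family is exponential with log-partition function `log B(a, b) = log Γ(a) + log Γ(b) -
log Γ(a + b)`, so the divergence between two members is a Bregman divergence: `betaDiv_eq_gap`
writes it as two one-dimensional gaps of the convex function `log Γ` minus a third, which is
nonnegative and can be dropped. A gap over an interval of length `n` is at most `n` times the
increment of the digamma function `ψ`. Since `log x - 1/x ≤ ψ(x) ≤ log x` and `ψ ≥ 0` on `[2, ∞)`,
each cell loss lies in `[0, n (log (α + n) + log (β + n))]`.

This yields the constants of bounded differences. The total loss is a sum of independent bounded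
terms, so the tail bound is Hoeffding's inequality; the joint divergence is that sum by additivity
over products (`klDiv_pi`).

The only property of Laplace noise used for the expectations is symmetry: positive and negative
noise each have probability at most 1/2, so the mean is at most half the sum of the worst cases
above and below the true counts. For (d) these worst cases telescope, and `1 - exp(-n/b) ≥ 1 - 1/e ≥
1/2`. For (c) the bound may involve only the true counts, so upward moves are estimated through
monotonicity of `log B` instead (`betaDiv_le_max_add_gap_min`).

In (e) the bound holds surely: the loss is `O(m n log n)` for every output, and `1 - exp(-n/b)` is
bounded below in terms of `s`. -/

/-- The real digamma function, the derivative of `log ∘ Γ`. -/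
noncomputable def realDigamma (x : ℝ) : ℝ := deriv (Real.log ∘ Real.Gamma) x

theorem hasDerivAt_log_Gamma {x : ℝ} (hx : 0 < x) :
    HasDerivAt (Real.log ∘ Real.Gamma) (realDigamma x) x := by
  have h : DifferentiableAt ℝ Real.Gamma x := by
    refine Real.differentiableAt_Gamma fun m => ?_
    have : (0 : ℝ) ≤ m := m.cast_nonneg
    intro h
    linarith
  exact (h.log (Real.Gamma_pos_of_pos hx).ne').hasDerivAt

theorem realDigamma_mono {x y : ℝ} (hx : 0 < x) (hxy : x ≤ y) :
    realDigamma x ≤ realDigamma y :=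
  Real.convexOn_log_Gamma.monotoneOn_deriv (fun _ h => (hasDerivAt_log_Gamma h).differentiableAt)
    hx (hx.trans_le hxy) hxy

theorem log_Gamma_add_one {x : ℝ} (hx : 0 < x) :
    Real.log (Real.Gamma (x + 1)) = Real.log (Real.Gamma x) + Real.log x := by
  rw [Real.Gamma_add_one hx.ne', Real.log_mul hx.ne' (Real.Gamma_pos_of_pos hx).ne', add_comm]

/-- The convex function `log ∘ Γ` lies above its tangents. -/
theorem log_Gamma_tangent_le {x y : ℝ} (hx : 0 < x) (hy : 0 < y) :
    (y - x) * realDigamma x ≤ Real.log (Real.Gamma y) - Real.log (Real.Gamma x) := by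
  rcases lt_trichotomy x y with h | rfl | h
  · have := Real.convexOn_log_Gamma.le_slope_of_hasDerivAt hx hy h (hasDerivAt_log_Gamma hx)
    rw [slope_def_field, le_div_iff₀ (by linarith)] at this
    simp only [Function.comp_apply] at this
    linarith
  · simp
  · have := Real.convexOn_log_Gamma.slope_le_of_hasDerivAt hy hx h (hasDerivAt_log_Gamma hx)
    rw [slope_def_field, div_le_iff₀ (by linarith)] at this
    simp only [Function.comp_apply] at this
    linarith

theorem realDigamma_add_one {x : ℝ} (hx : 0 < x) :
    realDigamma (x + 1) = realDigamma x + 1 / x := by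
  have h1 : HasDerivAt (fun t => Real.log (Real.Gamma (t + 1))) (realDigamma (x + 1)) x := by
    simpa using (hasDerivAt_log_Gamma (by linarith : 0 < x + 1)).comp_add_const x 1
  have h2 : HasDerivAt (fun t => Real.log (Real.Gamma t) + Real.log t)
      (realDigamma x + 1 / x) x := by
    rw [one_div]
    exact (hasDerivAt_log_Gamma hx).add (Real.hasDerivAt_log hx.ne')
  refine h1.unique (h2.congr_of_eventuallyEq ?_)
  filter_upwards [lt_mem_nhds hx] with t ht using log_Gamma_add_one ht

/-- The tangent at `x` is compared with the value at `x + 1`, where `log Γ` has grown by exactly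
`log x`. The lower bound that follows uses the tangent at `x + 1` and the value at `x`. -/
theorem realDigamma_le_log {x : ℝ} (hx : 0 < x) : realDigamma x ≤ Real.log x := by
  have := log_Gamma_tangent_le hx (by linarith : 0 < x + 1)
  rw [log_Gamma_add_one hx] at this
  linarith

theorem log_sub_inv_le_realDigamma {x : ℝ} (hx : 0 < x) :
    Real.log x - 1 / x ≤ realDigamma x := by
  have := log_Gamma_tangent_le (by linarith : 0 < x + 1) hx
  rw [log_Gamma_add_one hx, realDigamma_add_one hx] at this
  linarith

/-- This is where priors `≥ 2` enter: `ψ(2) ≥ log 2 - 1/2 > 0`, so a subtracted `ψ(α)` can be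
discarded. -/
theorem realDigamma_nonneg {x : ℝ} (hx : 2 ≤ x) : 0 ≤ realDigamma x := by
  have h1 := log_sub_inv_le_realDigamma (by norm_num : (0 : ℝ) < 2)
  have h2 := realDigamma_mono (by norm_num : (0 : ℝ) < 2) hx
  have := Real.log_two_gt_d9
  linarith

/-- Increments of a convex function over a fixed step `b` grow with the base point, as their
derivative `ψ(t + b) - ψ(t)` is nonnegative. -/
theorem log_Gamma_add_sub_mono {x y b : ℝ} (hx : 0 < x) (hxy : x ≤ y) (hb : 0 ≤ b) :
    Real.log (Real.Gamma y) - Real.log (Real.Gamma x)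
      ≤ Real.log (Real.Gamma (y + b)) - Real.log (Real.Gamma (x + b)) := by
  have hd : ∀ t ∈ Set.Ioi (0 : ℝ), HasDerivAt
      (fun t => (Real.log ∘ Real.Gamma) (t + b) - (Real.log ∘ Real.Gamma) t)
      (realDigamma (t + b) - realDigamma t) t := fun t ht =>
    ((hasDerivAt_log_Gamma (add_pos_of_pos_of_nonneg ht hb)).comp_add_const t b).sub
      (hasDerivAt_log_Gamma ht)
  have hm : MonotoneOn (fun t => (Real.log ∘ Real.Gamma) (t + b) - (Real.log ∘ Real.Gamma) t)
      (Set.Ioi 0) := by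
    refine monotoneOn_of_deriv_nonneg (convex_Ioi 0)
      (fun t ht => (hd t ht).continuousAt.continuousWithinAt) ?_ ?_
    · rw [interior_Ioi]
      exact fun t ht => (hd t ht).differentiableAt.differentiableWithinAt
    · rw [interior_Ioi]
      intro t ht
      rw [(hd t ht).deriv, sub_nonneg]
      exact realDigamma_mono ht (by linarith)
  have := hm hx (hx.trans_le hxy) hxy
  simp only [Function.comp_apply] at this
  linarith

/-- The Bregman divergence of `log ∘ Γ`. -/
noncomputable def logGammaGap (y x : ℝ) : ℝ :=
  Real.log (Real.Gamma y) - Real.log (Real.Gamma x) - (y - x) * realDigamma x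

theorem logGammaGap_self (x : ℝ) : logGammaGap x x = 0 := by simp [logGammaGap]

theorem logGammaGap_nonneg {x y : ℝ} (hx : 0 < x) (hy : 0 < y) : 0 ≤ logGammaGap y x := by
  have := log_Gamma_tangent_le hx hy
  unfold logGammaGap
  linarith

/-- The two gaps between `x` and `y` add up to the right-hand side, and the reverse one is
nonnegative. -/
theorem logGammaGap_le {x y : ℝ} (hx : 0 < x) (hy : 0 < y) :
    logGammaGap y x ≤ (y - x) * (realDigamma y - realDigamma x) := by
  have := log_Gamma_tangent_le hy hx
  unfold logGammaGap
  linarith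

/-- The upward and downward cases are kept apart because noise of either sign is charged separately;
for a common factor `d` the two bounds telescope in `ψ`. -/
theorem logGammaGap_le_of_le {x y u d : ℝ} (hx : 0 < x) (hxy : x ≤ y) (hyu : y ≤ u)
    (hd : y - x ≤ d) : logGammaGap y x ≤ d * (realDigamma u - realDigamma x) := by
  have h0 := realDigamma_mono hx hxy
  have h1 := realDigamma_mono (hx.trans_le hxy) hyu
  refine (logGammaGap_le hx (hx.trans_le hxy)).trans ?_
  exact mul_le_mul hd (by linarith) (by linarith) (by linarith)

theorem logGammaGap_le_of_ge {x y l d : ℝ} (hl : 0 < l) (hly : l ≤ y) (hyx : y ≤ x)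
    (hd : x - y ≤ d) : logGammaGap y x ≤ d * (realDigamma x - realDigamma l) := by
  have h0 := realDigamma_mono (hl.trans_le hly) hyx
  have h1 := realDigamma_mono hl hly
  refine (logGammaGap_le (hl.trans_le (hly.trans hyx)) (hl.trans_le hly)).trans ?_
  rw [show (y - x) * (realDigamma y - realDigamma x)
    = (x - y) * (realDigamma x - realDigamma y) by ring]
  exact mul_le_mul hd (by linarith) (by linarith) (by linarith)

/-- A Bregman divergence over an interval is at most the length of the interval times the
increment of the derivative. -/
theorem logGammaGap_le_of_mem {x y l u : ℝ} (hl : 0 < l) (hx : x ∈ Set.Icc l u)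
    (hy : y ∈ Set.Icc l u) :
    logGammaGap y x ≤ (u - l) * (realDigamma u - realDigamma l) := by
  have hx0 := hl.trans_le hx.1
  have hy0 := hl.trans_le hy.1
  rcases le_total x y with h | h
  · refine (logGammaGap_le_of_le hx0 h hy.2 le_rfl).trans ?_
    have h1 := realDigamma_mono hl hx.1
    have h2 := realDigamma_mono hx0 hx.2
    exact mul_le_mul (by linarith [hx.1, hy.2]) (by linarith) (by linarith)
      (by linarith [hx.1, hx.2])
  · refine (logGammaGap_le_of_ge hl hy.1 h le_rfl).trans ?_
    have h1 := realDigamma_mono hl hx.1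
    have h2 := realDigamma_mono hx0 hx.2
    exact mul_le_mul (by linarith [hx.2, hy.1]) (by linarith) (by linarith)
      (by linarith [hx.1, hx.2])

/-! ### The divergence between two Beta distributions as a function of the parameters -/

/-- The closed form of the divergence from `Beta(a, b)` to `Beta(a', b')`. -/
noncomputable def betaDiv (a b a' b' : ℝ) : ℝ :=
  Real.log (beta a' b') - Real.log (beta a b)
    + (a - a') * (realDigamma a - realDigamma (a + b))
    + (b - b') * (realDigamma b - realDigamma (a + b))

theorem log_beta {a b : ℝ} (ha : 0 < a) (hb : 0 < b) :
    Real.log (beta a b) = Real.log (Real.Gamma a) + Real.log (Real.Gamma b)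
      - Real.log (Real.Gamma (a + b)) := by
  have h1 := Real.Gamma_pos_of_pos ha
  have h2 := Real.Gamma_pos_of_pos hb
  have h3 := Real.Gamma_pos_of_pos (add_pos ha hb)
  rw [beta, Real.log_div (by positivity) h3.ne', Real.log_mul h1.ne' h2.ne']

theorem betaDiv_eq_gap {a b a' b' : ℝ} (ha : 0 < a) (hb : 0 < b) (ha' : 0 < a') (hb' : 0 < b') :
    betaDiv a b a' b'
      = logGammaGap a' a + logGammaGap b' b - logGammaGap (a' + b') (a + b) := by
  rw [betaDiv, log_beta ha hb, log_beta ha' hb', logGammaGap, logGammaGap, logGammaGap]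
  ring

theorem betaDiv_le_gap_add_gap {a b a' b' : ℝ} (ha : 0 < a) (hb : 0 < b) (ha' : 0 < a')
    (hb' : 0 < b') : betaDiv a b a' b' ≤ logGammaGap a' a + logGammaGap b' b := by
  have := logGammaGap_nonneg (add_pos ha hb) (add_pos ha' hb')
  rw [betaDiv_eq_gap ha hb ha' hb']
  linarith

/-- The path raises `a` to `a'` with `b` fixed, then `b` to `b'` with `a'` fixed; in each move the
growth of `log Γ(a + b)` dominates. -/
theorem log_beta_anti {a b a' b' : ℝ} (ha : 0 < a) (hb : 0 < b) (haa : a ≤ a') (hbb : b ≤ b') :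
    Real.log (beta a' b') ≤ Real.log (beta a b) := by
  have h1 := log_Gamma_add_sub_mono ha haa hb.le
  have h2 := log_Gamma_add_sub_mono hb hbb (ha.trans_le haa).le
  rw [log_beta ha hb, log_beta (ha.trans_le haa) (hb.trans_le hbb)]
  rw [add_comm b', add_comm b] at h2
  linarith

/-- Increasing a parameter costs at most linearly, decreasing it at most a Bregman divergence. -/
theorem betaDiv_le_max_add_gap_min {a b a' b' : ℝ} (ha : 0 < a) (hb : 0 < b) (ha' : 0 < a')
    (hb' : 0 < b') :
    betaDiv a b a' b' ≤ max 0 (a' - a) * (realDigamma (a + b) - realDigamma a)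
      + logGammaGap (min a' a) a
      + (max 0 (b' - b) * (realDigamma (a + b) - realDigamma b) + logGammaGap (min b' b) b) := by
  have hA : 0 < min a' a := lt_min ha' ha
  have hB : 0 < min b' b := lt_min hb' hb
  -- Lowering the target parameters to their minima with `a`, `b` can only increase `log B`; the
  -- linear terms that this removes are restored by `max 0 (a' - a)` and `max 0 (b' - b)`.
  have h1 := log_beta_anti hA hB (min_le_left a' a) (min_le_left b' b)
  have h2 := betaDiv_le_gap_add_gap ha hb hA hB
  have h3 : max 0 (a' - a) = a' - min a' a := by
    rcases le_total a' a with h | h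
    · rw [min_eq_left h, max_eq_left (by linarith), sub_self]
    · rw [min_eq_right h, max_eq_right (by linarith)]
  have h4 : max 0 (b' - b) = b' - min b' b := by
    rcases le_total b' b with h | h
    · rw [min_eq_left h, max_eq_left (by linarith), sub_self]
    · rw [min_eq_right h, max_eq_right (by linarith)]
  rw [h3, h4]
  unfold betaDiv at h2 ⊢
  linarith

/-- Over a box of side `n` the divergence is at most `n` times a sum of logarithms. -/
theorem betaDiv_le_log {α β n a b a' b' : ℝ} (hα : 2 ≤ α) (hβ : 2 ≤ β) (hn : 0 ≤ n)
    (ha : a ∈ Set.Icc α (α + n)) (hb : b ∈ Set.Icc β (β + n))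
    (ha' : a' ∈ Set.Icc α (α + n)) (hb' : b' ∈ Set.Icc β (β + n)) :
    betaDiv a b a' b' ≤ n * (Real.log (α + n) + Real.log (β + n)) := by
  have h1 := logGammaGap_le_of_mem (by linarith) ha ha'
  have h2 := logGammaGap_le_of_mem (by linarith) hb hb'
  have h3 := betaDiv_le_gap_add_gap (a := a) (b := b) (a' := a') (b' := b')
    (by linarith [ha.1]) (by linarith [hb.1]) (by linarith [ha'.1]) (by linarith [hb'.1])
  have h4 : realDigamma (α + n) - realDigamma α ≤ Real.log (α + n) := by
    linarith [realDigamma_le_log (by linarith : 0 < α + n), realDigamma_nonneg hα]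
  have h5 : realDigamma (β + n) - realDigamma β ≤ Real.log (β + n) := by
    linarith [realDigamma_le_log (by linarith : 0 < β + n), realDigamma_nonneg hβ]
  have h6 := mul_le_mul_of_nonneg_left h4 hn
  have h7 := mul_le_mul_of_nonneg_left h5 hn
  rw [add_sub_cancel_left] at h1 h2
  linarith

/-- For `a, b ≥ 2` one has `a + b ≤ a b`, so `log a` cancels; the `1/2` bounds the error `1/a`. -/
theorem realDigamma_add_sub_le {a b : ℝ} (ha : 2 ≤ a) (hb : 2 ≤ b) :
    realDigamma (a + b) - realDigamma a ≤ Real.log b + 1 / 2 := by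
  have h1 := realDigamma_le_log (by linarith : 0 < a + b)
  have h2 := log_sub_inv_le_realDigamma (by linarith : 0 < a)
  have h3 : Real.log (a + b) ≤ Real.log a + Real.log b := by
    rw [← Real.log_mul (by linarith) (by linarith)]
    exact Real.log_le_log (by linarith) (by nlinarith)
  have h4 : 1 / a ≤ 1 / 2 := one_div_le_one_div_of_le (by norm_num) ha
  linarith

/-- The sum of the four worst cases of `betaDiv_le_max_add_gap_min`. -/
theorem worst_case_sum_le {α β a b n k l : ℝ} (hα : 2 ≤ α) (hβ : 2 ≤ β) (hk : 0 ≤ k) (hl : 0 ≤ l)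
    (hkl : k + l ≤ n) (ha : a = α + k) (hb : b = β + l) :
    (n - k) * (realDigamma (a + b) - realDigamma a) + k * (realDigamma a - realDigamma α)
      + ((n - l) * (realDigamma (a + b) - realDigamma b) + l * (realDigamma b - realDigamma β))
      ≤ 2 * (n * Real.log (a * b)) := by
  have ha2 : 2 ≤ a := by linarith
  have hb2 : 2 ≤ b := by linarith
  have h1 := realDigamma_add_sub_le ha2 hb2
  have h2 := realDigamma_add_sub_le hb2 ha2
  rw [add_comm b a] at h2
  have h3 : realDigamma a - realDigamma α ≤ Real.log a := by
    linarith [realDigamma_le_log (by linarith : 0 < a), realDigamma_nonneg hα]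
  have h4 : realDigamma b - realDigamma β ≤ Real.log b := by
    linarith [realDigamma_le_log (by linarith : 0 < b), realDigamma_nonneg hβ]
  have g1 := mul_le_mul_of_nonneg_left h1 (by linarith : 0 ≤ n - k)
  have g2 := mul_le_mul_of_nonneg_left h2 (by linarith : 0 ≤ n - l)
  have g3 := mul_le_mul_of_nonneg_left h3 hk
  have g4 := mul_le_mul_of_nonneg_left h4 hl
  have la : 1 / 2 ≤ Real.log a := by
    have := Real.log_le_log (by norm_num) ha2
    linarith [Real.log_two_gt_d9]
  have lb : 1 / 2 ≤ Real.log b := by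
    have := Real.log_le_log (by norm_num) hb2
    linarith [Real.log_two_gt_d9]
  -- After `g1`–`g4` the right-hand side has a surplus of `n + k - l` copies of `log b` and `n + l -
  -- k` of `log a`. Each logarithm is at least `1/2`, which pays for the leftover `(n - k)/2 + (n -
  -- l)/2`.
  have g5 := mul_le_mul_of_nonneg_left lb (by linarith : 0 ≤ n + k - l)
  have g6 := mul_le_mul_of_nonneg_left la (by linarith : 0 ≤ n + l - k)
  rw [Real.log_mul (by linarith) (by linarith)]
  nlinarith

/-! ### The Kullback-Leibler divergence between Beta distributions -/

/-- The density of `Beta(a, b)` with respect to `Beta(a', b')`. -/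
noncomputable def betaRatio (a b a' b' x : ℝ) : ℝ :=
  beta a' b' / beta a b * (x ^ (a - a') * (1 - x) ^ (b - b'))

theorem measurable_betaRatio (a b a' b' : ℝ) : Measurable (betaRatio a b a' b') := by
  unfold betaRatio
  fun_prop

theorem measurable_betaPDF (a b : ℝ) : Measurable (betaPDF a b) :=
  (measurable_betaPDFReal a b).ennreal_ofReal

theorem betaPDF_eq_mul_betaRatio {a b a' b' : ℝ} (ha : 0 < a) (hb : 0 < b) (ha' : 0 < a')
    (hb' : 0 < b') (x : ℝ) :
    betaPDF a b x = betaPDF a' b' x * ENNReal.ofReal (betaRatio a b a' b' x) := by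
  rcases le_or_gt x 0 with h0 | h0
  · rw [betaPDF_eq_zero_of_nonpos h0, betaPDF_eq_zero_of_nonpos h0, zero_mul]
  rcases le_or_gt 1 x with h1 | h1
  · rw [betaPDF_eq_zero_of_one_le h1, betaPDF_eq_zero_of_one_le h1, zero_mul]
  have hB := beta_pos ha hb
  have hB' := beta_pos ha' hb'
  have hx : 0 < 1 - x := by linarith
  rw [betaPDF_of_pos_lt_one h0 h1, betaPDF_of_pos_lt_one h0 h1,
    ← ENNReal.ofReal_mul (by positivity),
    betaRatio, show a - 1 = (a' - 1) + (a - a') by ring, show b - 1 = (b' - 1) + (b - b') by ring,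
    Real.rpow_add h0, Real.rpow_add hx]
  congr 1
  field_simp

theorem betaMeasure_eq_withDensity {a b a' b' : ℝ} (ha : 0 < a) (hb : 0 < b) (ha' : 0 < a')
    (hb' : 0 < b') :
    betaMeasure a b
      = (betaMeasure a' b').withDensity fun x => ENNReal.ofReal (betaRatio a b a' b' x) := by
  rw [betaMeasure, betaMeasure,
    ← withDensity_mul _ (measurable_betaPDF _ _) (measurable_betaRatio _ _ _ _).ennreal_ofReal]
  congr 1
  exact funext (betaPDF_eq_mul_betaRatio ha hb ha' hb')

theorem betaMeasure_ac {a b a' b' : ℝ} (ha : 0 < a) (hb : 0 < b) (ha' : 0 < a') (hb' : 0 < b') :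
    betaMeasure a b ≪ betaMeasure a' b' := by
  rw [betaMeasure_eq_withDensity ha hb ha' hb']
  exact withDensity_absolutelyContinuous _ _

theorem ae_mem_Ioo_betaMeasure (a b : ℝ) : ∀ᵐ x ∂betaMeasure a b, x ∈ Set.Ioo (0 : ℝ) 1 := by
  rw [betaMeasure, ae_withDensity_iff (measurable_betaPDF a b)]
  refine ae_of_all _ fun x hx => ⟨?_, ?_⟩
  · by_contra h
    exact hx (betaPDF_eq_zero_of_nonpos (not_lt.1 h))
  · by_contra h
    exact hx (betaPDF_eq_zero_of_one_le (not_lt.1 h))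

/-- The mixed moments of a Beta distribution. -/
theorem lintegral_rpow_betaMeasure {a b s t : ℝ} (ha : 0 < a) (hb : 0 < b) (has : 0 < a + s)
    (hbt : 0 < b + t) :
    ∫⁻ x, ENNReal.ofReal (x ^ s * (1 - x) ^ t) ∂betaMeasure a b
      = ENNReal.ofReal (beta (a + s) (b + t) / beta a b) := by
  -- The moment is a ratio of normalising constants: `Beta(a + s, b + t)` has mass one and a density
  -- proportional to `x ^ s * (1 - x) ^ t` relative to `Beta(a, b)`.
  have h := (isProbabilityMeasureBeta has hbt).measure_univ
  have hB := beta_pos ha hb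
  have hB' := beta_pos has hbt
  rw [betaMeasure_eq_withDensity has hbt ha hb, withDensity_apply _ MeasurableSet.univ,
    Measure.restrict_univ] at h
  simp only [betaRatio, add_sub_cancel_left] at h
  simp_rw [ENNReal.ofReal_mul (div_pos hB hB').le] at h
  rw [lintegral_const_mul _ (by fun_prop)] at h
  rw [mul_comm] at h
  rw [ENNReal.eq_inv_of_mul_eq_one_left h, ← ENNReal.ofReal_inv_of_pos (by positivity),
    inv_div]

theorem integrable_rpow_betaMeasure {a b s t : ℝ} (ha : 0 < a) (hb : 0 < b) (has : 0 < a + s)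
    (hbt : 0 < b + t) : Integrable (fun x => x ^ s * (1 - x) ^ t) (betaMeasure a b) := by
  refine ⟨by fun_prop, ?_⟩
  rw [hasFiniteIntegral_iff_ofReal, lintegral_rpow_betaMeasure ha hb has hbt]
  · exact ENNReal.ofReal_lt_top
  · filter_upwards [ae_mem_Ioo_betaMeasure a b] with x hx
    have := hx.1
    have : 0 < 1 - x := by linarith [hx.2]
    simp only [Pi.zero_apply]
    positivity

theorem integral_rpow_betaMeasure {a b s t : ℝ} (ha : 0 < a) (hb : 0 < b) (has : 0 < a + s)
    (hbt : 0 < b + t) :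
    ∫ x, x ^ s * (1 - x) ^ t ∂betaMeasure a b = beta (a + s) (b + t) / beta a b := by
  rw [integral_eq_lintegral_of_nonneg_ae _ (by fun_prop), lintegral_rpow_betaMeasure ha hb has hbt,
    ENNReal.toReal_ofReal (div_pos (beta_pos has hbt) (beta_pos ha hb)).le]
  filter_upwards [ae_mem_Ioo_betaMeasure a b] with x hx
  have := hx.1
  have : 0 < 1 - x := by linarith [hx.2]
  simp only [Pi.zero_apply]
  positivity

/-- A random variable whose moment generating function is finite and known near `0` is integrable,
and its mean is the derivative at `0`. -/
theorem integrable_and_integral_eq_of_mgf {Ω : Type*} [MeasurableSpace Ω] {μ : Measure Ω}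
    {X : Ω → ℝ} {F : ℝ → ℝ} {d : ℝ} {U : Set ℝ} (hU : U ∈ nhds 0)
    (hint : ∀ t ∈ U, Integrable (fun ω => Real.exp (t * X ω)) μ)
    (hF : ∀ t ∈ U, mgf X μ t = F t) (hd : HasDerivAt F d 0) :
    Integrable X μ ∧ ∫ ω, X ω ∂μ = d := by
  have h0 : (0 : ℝ) ∈ interior (integrableExpSet X μ) := by
    rw [mem_interior_iff_mem_nhds]
    exact Filter.mem_of_superset hU hint
  refine ⟨?_, ?_⟩
  · simpa using integrable_pow_of_mem_interior_integrableExpSet h0 1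
  · rw [← deriv_mgf_zero h0]
    refine (hd.congr_of_eventuallyEq ?_).deriv
    filter_upwards [hU] with t ht using hF t ht

/-- The moment generating function of `log x` is `t ↦ E x ^ t = B(a + t, b) / B(a, b)`; writing it
as an exponential of `log Γ` terms makes its logarithmic derivative at `0` a difference of digammas.
-/
theorem log_betaMeasure {a b : ℝ} (ha : 0 < a) (hb : 0 < b) :
    Integrable Real.log (betaMeasure a b)
      ∧ ∫ x, Real.log x ∂betaMeasure a b = realDigamma a - realDigamma (a + b) := by
  have hexp : ∀ t : ℝ, (fun x => Real.exp (t * Real.log x))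
      =ᵐ[betaMeasure a b] fun x => x ^ t * (1 - x) ^ (0 : ℝ) := fun t => by
    filter_upwards [ae_mem_Ioo_betaMeasure a b] with x hx
    rw [Real.rpow_zero, mul_one, Real.rpow_def_of_pos hx.1, mul_comm]
  refine integrable_and_integral_eq_of_mgf (U := Set.Ioi (-a))
    (F := fun t => Real.exp ((Real.log ∘ Real.Gamma) (a + t) - (Real.log ∘ Real.Gamma) (a + b + t)
      + (Real.log (Real.Gamma b) - Real.log (beta a b))))
    (Ioi_mem_nhds (by linarith)) ?_ ?_ ?_
  · intro t ht
    exact (integrable_rpow_betaMeasure ha hb (by linarith [Set.mem_Ioi.1 ht]) (by linarith)).congr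
      (hexp t).symm
  · intro t ht
    have hat : 0 < a + t := by linarith [Set.mem_Ioi.1 ht]
    rw [mgf, integral_congr_ae (hexp t),
      integral_rpow_betaMeasure ha hb hat (by linarith), add_zero,
      ← Real.exp_log (div_pos (beta_pos hat hb) (beta_pos ha hb)),
      Real.log_div (beta_pos hat hb).ne' (beta_pos ha hb).ne', log_beta hat hb]
    simp only [Function.comp_apply]
    rw [add_right_comm a b t]
    ring_nf
  · have h1 := (hasDerivAt_log_Gamma (by linarith : 0 < a + 0)).comp_const_add a 0
    have h2 := (hasDerivAt_log_Gamma (by linarith : 0 < a + b + 0)).comp_const_add (a + b) 0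
    convert! ((h1.sub h2).add_const (Real.log (Real.Gamma b) - Real.log (beta a b))).exp using 1
    have : (Real.log ∘ Real.Gamma) (a + 0) - (Real.log ∘ Real.Gamma) (a + b + 0)
      + (Real.log (Real.Gamma b) - Real.log (beta a b)) = 0 := by
      rw [log_beta ha hb]
      simp only [add_zero, Function.comp_apply]
      ring
    simp only [Pi.sub_apply]
    rw [this]
    simp

theorem log_one_sub_betaMeasure {a b : ℝ} (ha : 0 < a) (hb : 0 < b) :
    Integrable (fun x => Real.log (1 - x)) (betaMeasure a b)
      ∧ ∫ x, Real.log (1 - x) ∂betaMeasure a b = realDigamma b - realDigamma (a + b) := by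
  have hexp : ∀ t : ℝ, (fun x => Real.exp (t * Real.log (1 - x)))
      =ᵐ[betaMeasure a b] fun x => x ^ (0 : ℝ) * (1 - x) ^ t := fun t => by
    filter_upwards [ae_mem_Ioo_betaMeasure a b] with x hx
    rw [Real.rpow_zero, one_mul, Real.rpow_def_of_pos (by linarith [hx.2]), mul_comm]
  refine integrable_and_integral_eq_of_mgf (U := Set.Ioi (-b))
    (F := fun t => Real.exp ((Real.log ∘ Real.Gamma) (b + t) - (Real.log ∘ Real.Gamma) (a + b + t)
      + (Real.log (Real.Gamma a) - Real.log (beta a b))))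
    (Ioi_mem_nhds (by linarith)) ?_ ?_ ?_
  · intro t ht
    exact (integrable_rpow_betaMeasure ha hb (by linarith) (by linarith [Set.mem_Ioi.1 ht])).congr
      (hexp t).symm
  · intro t ht
    have hbt : 0 < b + t := by linarith [Set.mem_Ioi.1 ht]
    rw [mgf, integral_congr_ae (hexp t),
      integral_rpow_betaMeasure ha hb (by linarith) hbt, add_zero,
      ← Real.exp_log (div_pos (beta_pos ha hbt) (beta_pos ha hb)),
      Real.log_div (beta_pos ha hbt).ne' (beta_pos ha hb).ne', log_beta ha hbt]
    simp only [Function.comp_apply]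
    ring_nf
  · have h1 := (hasDerivAt_log_Gamma (by linarith : 0 < b + 0)).comp_const_add b 0
    have h2 := (hasDerivAt_log_Gamma (by linarith : 0 < a + b + 0)).comp_const_add (a + b) 0
    convert! ((h1.sub h2).add_const (Real.log (Real.Gamma a) - Real.log (beta a b))).exp using 1
    have : (Real.log ∘ Real.Gamma) (b + 0) - (Real.log ∘ Real.Gamma) (a + b + 0)
      + (Real.log (Real.Gamma a) - Real.log (beta a b)) = 0 := by
      rw [log_beta ha hb]
      simp only [add_zero, Function.comp_apply]
      ring
    simp only [Pi.sub_apply]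
    rw [this]
    simp

theorem llr_betaMeasure {a b a' b' : ℝ} (ha : 0 < a) (hb : 0 < b) (ha' : 0 < a') (hb' : 0 < b') :
    llr (betaMeasure a b) (betaMeasure a' b') =ᵐ[betaMeasure a b] fun x =>
      (Real.log (beta a' b') - Real.log (beta a b)) + ((a - a') * Real.log x
        + (b - b') * Real.log (1 - x)) := by
  have := isProbabilityMeasureBeta ha' hb'
  have h : (betaMeasure a b).rnDeriv (betaMeasure a' b') =ᵐ[betaMeasure a b]
      fun x => ENNReal.ofReal (betaRatio a b a' b' x) := by
    refine (betaMeasure_ac ha hb ha' hb').ae_eq ?_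
    rw [betaMeasure_eq_withDensity ha hb ha' hb']
    exact Measure.rnDeriv_withDensity _ (measurable_betaRatio _ _ _ _).ennreal_ofReal
  filter_upwards [h, ae_mem_Ioo_betaMeasure a b] with x hx hx01
  have h0 := hx01.1
  have h1 : 0 < 1 - x := by linarith [hx01.2]
  have hB := beta_pos ha hb
  have hB' := beta_pos ha' hb'
  have p1 := Real.rpow_pos_of_pos h0 (a - a')
  have p2 := Real.rpow_pos_of_pos h1 (b - b')
  rw [llr, hx, betaRatio, ENNReal.toReal_ofReal (by positivity),
    Real.log_mul (by positivity) (by positivity), Real.log_div hB'.ne' hB.ne',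
    Real.log_mul p1.ne' p2.ne', Real.log_rpow h0, Real.log_rpow h1]

theorem integrable_llr_betaMeasure {a b a' b' : ℝ} (ha : 0 < a) (hb : 0 < b) (ha' : 0 < a')
    (hb' : 0 < b') :
    Integrable (llr (betaMeasure a b) (betaMeasure a' b')) (betaMeasure a b) := by
  have := isProbabilityMeasureBeta ha hb
  refine Integrable.congr ?_ (llr_betaMeasure ha hb ha' hb').symm
  exact (integrable_const _).add
    (((log_betaMeasure ha hb).1.const_mul _).add ((log_one_sub_betaMeasure ha hb).1.const_mul _))

theorem toReal_klDiv_betaMeasure {a b a' b' : ℝ} (ha : 0 < a) (hb : 0 < b) (ha' : 0 < a')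
    (hb' : 0 < b') :
    (klDiv (betaMeasure a b) (betaMeasure a' b')).toReal = betaDiv a b a' b' := by
  have := isProbabilityMeasureBeta ha hb
  have := isProbabilityMeasureBeta ha' hb'
  have h1 := log_betaMeasure ha hb
  have h2 := log_one_sub_betaMeasure ha hb
  rw [toReal_klDiv_of_measure_eq (betaMeasure_ac ha hb ha' hb') (by simp),
    integral_congr_ae (llr_betaMeasure ha hb ha' hb'),
    integral_add (integrable_const _)
      (f := fun _ => Real.log (beta a' b') - Real.log (beta a b))
      (g := fun x => (a - a') * Real.log x + (b - b') * Real.log (1 - x))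
      ((h1.1.const_mul _).add (h2.1.const_mul _)),
    integral_add (h1.1.const_mul _) (h2.1.const_mul _), integral_const_mul, integral_const_mul,
    h1.2, h2.2, betaDiv]
  simp
  ring

theorem integral_id_betaMeasure {a b : ℝ} (ha : 0 < a) (hb : 0 < b) :
    ∫ x, x ∂betaMeasure a b = a / (a + b) := by
  have h := integral_rpow_betaMeasure (s := 1) (t := 0) ha hb (by linarith) (by linarith)
  simp only [Real.rpow_one, Real.rpow_zero, mul_one, add_zero] at h
  have h1 := Real.Gamma_pos_of_pos ha
  have h2 := Real.Gamma_pos_of_pos hb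
  have h3 := Real.Gamma_pos_of_pos (add_pos ha hb)
  rw [h, beta, beta, add_right_comm, Real.Gamma_add_one ha.ne', Real.Gamma_add_one (by positivity)]
  field_simp

/-- Beta distributions with the same second parameter and zero divergence coincide. -/
theorem eq_of_betaDiv_eq_zero {a b a' : ℝ} (ha : 0 < a) (hb : 0 < b) (ha' : 0 < a')
    (h : betaDiv a b a' b = 0) : a = a' := by
  have := isProbabilityMeasureBeta ha hb
  have := isProbabilityMeasureBeta ha' hb
  rw [← toReal_klDiv_betaMeasure ha hb ha' hb, ENNReal.toReal_eq_zero_iff] at h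
  have heq : betaMeasure a b = betaMeasure a' b := by
    refine klDiv_eq_zero_iff.1 (h.resolve_right ?_)
    exact klDiv_ne_top (betaMeasure_ac ha hb ha' hb) (integrable_llr_betaMeasure ha hb ha' hb)
  -- Equal laws have equal means, and `a / (a + b)` determines `a` once `b` is fixed.
  have hm := integral_id_betaMeasure ha hb
  rw [heq, integral_id_betaMeasure ha' hb, div_eq_div_iff (by positivity) (by positivity)] at hm
  have : (a' - a) * b = 0 := by linarith
  rcases mul_eq_zero.1 this with h | h <;> linarith

/-! ### The divergence of product measures -/

section Pi

variable {ι : Type*} [Fintype ι] {X : ι → Type*} [∀ i, MeasurableSpace (X i)]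

theorem lintegral_pi_prod_eq_prod_lintegral {ν : ∀ i, Measure (X i)}
    [∀ i, IsProbabilityMeasure (ν i)] {f : ∀ i, X i → ENNReal} (hf : ∀ i, Measurable (f i)) :
    ∫⁻ x, ∏ i, f i (x i) ∂Measure.pi ν = ∏ i, ∫⁻ y, f i y ∂ν i := by
  have hind : iIndepFun (fun i (x : ∀ i, X i) => f i (x i)) (Measure.pi ν) :=
    iIndepFun_pi fun i => (hf i).aemeasurable
  rw [lintegral_prod_eq_prod_lintegral_of_indepFun Finset.univ _ hind
    fun i => (hf i).comp (measurable_pi_apply i)]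
  refine Finset.prod_congr rfl fun i _ => ?_
  rw [← (measurePreserving_eval ν i).lintegral_comp (hf i)]

theorem pi_withDensity {ν : ∀ i, Measure (X i)} [∀ i, IsProbabilityMeasure (ν i)]
    {f : ∀ i, X i → ENNReal} (hf : ∀ i, Measurable (f i))
    [∀ i, SigmaFinite ((ν i).withDensity (f i))] :
    Measure.pi (fun i => (ν i).withDensity (f i))
      = (Measure.pi ν).withDensity fun x => ∏ i, f i (x i) := by
  refine Measure.pi_eq fun s hs => ?_
  rw [withDensity_apply _ (MeasurableSet.univ_pi hs),
    ← lintegral_indicator (MeasurableSet.univ_pi hs)]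
  -- The indicator of a box is a product of indicators, so the integral factors by independence of
  -- the coordinates.
  have h : ∀ x : ∀ i, X i, (Set.univ.pi s).indicator (fun x => ∏ i, f i (x i)) x
      = ∏ i, (s i).indicator (f i) (x i) := fun x => by
    by_cases hx : x ∈ Set.univ.pi s
    · rw [Set.indicator_of_mem hx]
      exact Finset.prod_congr rfl fun i _ =>
        (Set.indicator_of_mem (hx i (Set.mem_univ i)) (f i)).symm
    · rw [Set.indicator_of_notMem hx]
      simp only [Set.mem_univ_pi, not_forall] at hx
      obtain ⟨i, hi⟩ := hx
      exact (Finset.prod_eq_zero (Finset.mem_univ i) (Set.indicator_of_notMem hi (f i))).symm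
  simp_rw [h]
  rw [lintegral_pi_prod_eq_prod_lintegral fun i => (hf i).indicator (hs i)]
  refine Finset.prod_congr rfl fun i _ => ?_
  rw [lintegral_indicator (hs i), withDensity_apply _ (hs i)]

variable {μ ν : ∀ i, Measure (X i)} [∀ i, IsProbabilityMeasure (μ i)]
  [∀ i, IsProbabilityMeasure (ν i)]

theorem pi_eq_withDensity_rnDeriv (h : ∀ i, μ i ≪ ν i) :
    Measure.pi μ = (Measure.pi ν).withDensity fun x => ∏ i, (μ i).rnDeriv (ν i) (x i) := by
  rw [← pi_withDensity fun i => Measure.measurable_rnDeriv _ _]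
  congr 1
  exact funext fun i => (Measure.withDensity_rnDeriv_eq _ _ (h i)).symm

theorem pi_absolutelyContinuous (h : ∀ i, μ i ≪ ν i) : Measure.pi μ ≪ Measure.pi ν := by
  rw [pi_eq_withDensity_rnDeriv h]
  exact withDensity_absolutelyContinuous _ _

theorem llr_pi (h : ∀ i, μ i ≪ ν i) :
    llr (Measure.pi μ) (Measure.pi ν) =ᵐ[Measure.pi μ]
      fun x => ∑ i, llr (μ i) (ν i) (x i) := by
  have hr : (Measure.pi μ).rnDeriv (Measure.pi ν) =ᵐ[Measure.pi μ]
      fun x => ∏ i, (μ i).rnDeriv (ν i) (x i) := by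
    refine (pi_absolutelyContinuous h).ae_eq ?_
    rw [pi_eq_withDensity_rnDeriv h]
    exact Measure.rnDeriv_withDensity _ (Finset.measurable_prod _ fun i _ =>
      (Measure.measurable_rnDeriv _ _).comp (measurable_pi_apply i))
  -- The logarithm of a product splits only where every factor is neither zero nor infinite, which
  -- holds almost everywhere for `μ`.
  have hpos : ∀ᵐ x ∂Measure.pi μ, ∀ i, ((μ i).rnDeriv (ν i) (x i)).toReal ≠ 0 := by
    rw [ae_all_iff]
    intro i
    have h1 := (measurePreserving_eval μ i).quasiMeasurePreserving.ae (Measure.rnDeriv_pos (h i))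
    have h2 := (measurePreserving_eval μ i).quasiMeasurePreserving.ae
      ((h i).ae_le (Measure.rnDeriv_lt_top (μ i) (ν i)))
    filter_upwards [h1, h2] with x hx1 hx2 using (ENNReal.toReal_pos hx1.ne' hx2.ne).ne'
  filter_upwards [hr, hpos] with x hx hp
  rw [llr, hx, ENNReal.toReal_prod, Real.log_prod fun i _ => hp i]
  rfl

/-- The Kullback-Leibler divergence is additive over product measures. -/
theorem klDiv_pi (h : ∀ i, μ i ≪ ν i) (hint : ∀ i, Integrable (llr (μ i) (ν i)) (μ i)) :
    klDiv (Measure.pi μ) (Measure.pi ν)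
      = ENNReal.ofReal (∑ i, (klDiv (μ i) (ν i)).toReal) := by
  have hi : ∀ i, Integrable (fun x : ∀ i, X i => llr (μ i) (ν i) (x i)) (Measure.pi μ) :=
    fun i => integrable_comp_eval (hint i)
  have hI : Integrable (llr (Measure.pi μ) (Measure.pi ν)) (Measure.pi μ) :=
    (integrable_finsetSum _ fun i _ => hi i).congr (llr_pi h).symm
  have hac := pi_absolutelyContinuous h
  rw [← ENNReal.ofReal_toReal (klDiv_ne_top hac hI), toReal_klDiv_of_measure_eq hac (by simp),
    integral_congr_ae (llr_pi h), integral_finsetSum _ fun i _ => hi i]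
  congr 1
  refine Finset.sum_congr rfl fun i _ => ?_
  rw [toReal_klDiv_of_measure_eq (h i) (by simp)]
  exact integral_comp_eval (hint i).aestronglyMeasurable

end Pi

/-! ### Laplace noise is symmetric -/

theorem laplaceMeasure_map_neg (b : ℝ) : (laplaceMeasure b).map Neg.neg = laplaceMeasure b := by
  ext s hs
  rw [Measure.map_apply measurable_neg hs, laplaceMeasure,
    withDensity_apply _ (measurable_neg hs), withDensity_apply _ hs,
    ← (Measure.measurePreserving_neg (volume : Measure ℝ)).setLIntegral_comp_preimage hs
      (by fun_prop)]
  simp only [abs_neg]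

section Noise

variable {Ω : Type*} {N : Ω → ℝ}

/-- The function of the noise that is `x` where the noise is positive and `y` where it is
negative. -/
noncomputable def signStep (N : Ω → ℝ) (x y : ℝ) (ω : Ω) : ℝ :=
  {ω | 0 < N ω}.indicator (fun _ => x) ω + {ω | N ω < 0}.indicator (fun _ => y) ω

theorem signStep_of_pos {x y : ℝ} {ω : Ω} (h : 0 < N ω) : signStep N x y ω = x := by
  simp [signStep, h, h.le]

theorem signStep_of_neg {x y : ℝ} {ω : Ω} (h : N ω < 0) : signStep N x y ω = y := by
  simp [signStep, h, h.le]

theorem signStep_of_eq {x y : ℝ} {ω : Ω} (h : N ω = 0) : signStep N x y ω = 0 := by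
  simp [signStep, h]

/-- A cost that vanishes without noise, is at most `x` above the true count `k` and at most `y`
below it, is dominated by a step function of the noise. -/
theorem le_signStep_of_clamp {g : ℝ → ℝ} {k n x y : ℝ} (hk : k ∈ Set.Icc 0 n) (hg : g k ≤ 0)
    (hx : ∀ r ∈ Set.Icc k n, g r ≤ x) (hy : ∀ r ∈ Set.Icc 0 k, g r ≤ y) (ω : Ω) :
    g (max 0 (min (k + N ω) n)) ≤ signStep N x y ω := by
  have hn : 0 ≤ n := hk.1.trans hk.2
  rcases lt_trichotomy (N ω) 0 with h | h | h
  · rw [signStep_of_neg h]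
    refine hy _ ⟨le_max_left _ _, max_le hk.1 ((min_le_left _ _).trans (by linarith))⟩
  · rw [signStep_of_eq h, h, add_zero, min_eq_left hk.2, max_eq_right hk.1]
    exact hg
  · rw [signStep_of_pos h]
    refine hx _ ⟨le_max_of_le_right (le_min (by linarith) hk.2), max_le hn (min_le_right _ _)⟩

variable [MeasurableSpace Ω] {P : Measure Ω} {b : ℝ}

theorem measureReal_pos_eq_neg_of_laplace (hN : Measurable N) (hlaw : P.map N = laplaceMeasure b) :
    P.real {ω | 0 < N ω} = P.real {ω | N ω < 0} := by
  have h1 : P {ω | 0 < N ω} = laplaceMeasure b (Set.Ioi 0) := by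
    rw [← hlaw, Measure.map_apply hN measurableSet_Ioi]
    rfl
  have h2 : P {ω | N ω < 0} = laplaceMeasure b (Set.Iio 0) := by
    rw [← hlaw, Measure.map_apply hN measurableSet_Iio]
    rfl
  rw [measureReal_def, measureReal_def, h1, h2, ← laplaceMeasure_map_neg b,
    Measure.map_apply measurable_neg measurableSet_Ioi, laplaceMeasure_map_neg]
  simp

/-- The two half-lines are disjoint and equally likely; no computation with the density is needed.
-/
theorem measureReal_pos_le_half_of_laplace [IsProbabilityMeasure P] (hN : Measurable N)
    (hlaw : P.map N = laplaceMeasure b) : P.real {ω | 0 < N ω} ≤ 1 / 2 := by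
  have h := measureReal_pos_eq_neg_of_laplace hN hlaw
  have hd : Disjoint {ω | 0 < N ω} {ω | N ω < 0} :=
    Set.disjoint_left.2 fun ω (h1 : 0 < N ω) (h2 : N ω < 0) => lt_asymm h1 h2
  have hu := measureReal_union (μ := P) hd (measurableSet_lt hN measurable_const)
  have hle : P.real ({ω | 0 < N ω} ∪ {ω | N ω < 0}) ≤ 1 := measureReal_le_one
  linarith

theorem integrable_signStep [IsProbabilityMeasure P] (hN : Measurable N) (x y : ℝ) :
    Integrable (signStep N x y) P :=
  ((integrable_const x).indicator (measurableSet_lt measurable_const hN)).add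
    ((integrable_const y).indicator (measurableSet_lt hN measurable_const))

theorem integral_signStep_le [IsProbabilityMeasure P] (hN : Measurable N)
    (hlaw : P.map N = laplaceMeasure b) {x y : ℝ}
    (hx : 0 ≤ x) (hy : 0 ≤ y) : ∫ ω, signStep N x y ω ∂P ≤ (x + y) / 2 := by
  have h1 := measureReal_pos_le_half_of_laplace hN hlaw
  have h2 := h1
  rw [measureReal_pos_eq_neg_of_laplace hN hlaw] at h2
  have m1 : MeasurableSet {ω | 0 < N ω} := measurableSet_lt measurable_const hN
  have m2 : MeasurableSet {ω | N ω < 0} := measurableSet_lt hN measurable_const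
  unfold signStep
  rw [integral_add ((integrable_const x).indicator m1) ((integrable_const y).indicator m2),
    integral_indicator_const _ m1, integral_indicator_const _ m2, smul_eq_mul, smul_eq_mul]
  have := mul_le_mul_of_nonneg_right h1 hx
  have := mul_le_mul_of_nonneg_right h2 hy
  linarith

end Noise

/-! ### Bounded differences -/

/-- **Hoeffding's inequality** for functions of independent variables, with the radius expressed
through the failure probability. -/
theorem measure_sum_ge_le_of_bounded_differences {Ω ι : Type*} [Fintype ι] [MeasurableSpace Ω]
    {P : Measure Ω} [IsProbabilityMeasure P] {Y : ι → Ω → ℝ} (hY : ∀ i, Measurable (Y i))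
    (hind : iIndepFun Y P) {b m : ι → ℝ} (hm : ∀ i ω, Y i ω ∈ Set.Icc (m i) (m i + b i))
    (hb : 0 < ∑ i, b i ^ 2) {δ : ℝ} (hδ : 0 < δ) (hδ1 : δ ≤ 1) :
    P {ω | (∫ ω', ∑ i, Y i ω' ∂P) + Real.sqrt (-(1 / 2) * (∑ i, b i ^ 2) * Real.log δ)
      ≤ ∑ i, Y i ω} ≤ ENNReal.ofReal δ := by
  have hlog : Real.log δ ≤ 0 := Real.log_nonpos hδ.le hδ1
  have hint : ∀ i, Integrable (Y i) P := fun i =>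
    Integrable.of_mem_Icc (m i) (m i + b i) (hY i).aemeasurable (ae_of_all _ (hm i))
  have hsub : ∀ i ∈ Finset.univ, HasSubgaussianMGF (fun ω => Y i ω - ∫ ω', Y i ω' ∂P)
      ((‖m i + b i - m i‖₊ / 2) ^ 2) P := fun i _ =>
    hasSubgaussianMGF_of_mem_Icc (hY i).aemeasurable (ae_of_all _ (hm i))
  have hind' : iIndepFun (fun i ω => Y i ω - ∫ ω', Y i ω' ∂P) P :=
    hind.comp (fun i y => y - ∫ ω', Y i ω' ∂P) fun i => measurable_id.sub_const _
  have hH := HasSubgaussianMGF.measure_sum_ge_le_of_iIndepFun hind' hsub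
    (Real.sqrt_nonneg (-(1 / 2) * (∑ i, b i ^ 2) * Real.log δ))
  have hs : (∑ i, (((‖m i + b i - m i‖₊ / 2) ^ 2 : NNReal) : ℝ)) = (∑ i, b i ^ 2) / 4 := by
    rw [Finset.sum_div]
    refine Finset.sum_congr rfl fun i _ => ?_
    push_cast
    rw [add_sub_cancel_left, div_pow, Real.norm_eq_abs, sq_abs]
    norm_num
  rw [Real.sq_sqrt (by nlinarith), NNReal.coe_sum, hs] at hH
  -- Hoeffding's exponent `-t² / (2 · S / 4)` with `S = ∑ b i ^ 2` equals `log δ` for the chosen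
  -- radius. This needs `S ≠ 0`: for constant variables the event is certain.
  rw [show -(-(1 / 2) * (∑ i, b i ^ 2) * Real.log δ) / (2 * ((∑ i, b i ^ 2) / 4)) = Real.log δ by
    field_simp; ring, Real.exp_log hδ] at hH
  rw [← ENNReal.ofReal_toReal (measure_ne_top P _)]
  refine ENNReal.ofReal_le_ofReal (le_trans (le_of_eq ?_) hH)
  rw [measureReal_def]
  congr 2
  ext ω
  rw [Set.mem_ofPred_eq, Set.mem_ofPred_eq, integral_finsetSum _ fun i _ => hint i,
    Finset.sum_sub_distrib]
  constructor <;> intro h <;> linarith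

/-! ### The loss in a single cell -/

/-- The logarithm of the Gamma function along a truncated parameter is continuous. -/
theorem continuous_log_Gamma_add_max {α : ℝ} (hα : 0 < α) {Z : Type*} [TopologicalSpace Z]
    {g : Z → ℝ} (hg : Continuous g) :
    Continuous fun z => Real.log (Real.Gamma (α + max 0 (g z))) := by
  rw [continuous_iff_continuousAt]
  intro z
  have h : 0 < α + max 0 (g z) := add_pos_of_pos_of_nonneg hα (le_max_left _ _)
  exact (hasDerivAt_log_Gamma h).continuousAt.comp (f := fun z => α + max 0 (g z))
    (by fun_prop)

/-- The truncation `max 0` keeps the parameters positive on the whole plane, so a globally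
continuous function represents the loss on the box and supplies its measurability. -/
theorem continuous_betaDiv_max {α β : ℝ} (hα : 0 < α) (hβ : 0 < β) (a b : ℝ) :
    Continuous fun z : ℝ × ℝ => betaDiv a b (α + max 0 z.1) (β + max 0 z.2) := by
  have h : ∀ z : ℝ × ℝ, Real.log (beta (α + max 0 z.1) (β + max 0 z.2))
      = Real.log (Real.Gamma (α + max 0 z.1)) + Real.log (Real.Gamma (β + max 0 z.2))
        - Real.log (Real.Gamma (α + β + max 0 (max 0 z.1 + max 0 z.2))) := fun z => by
    have h1 : 0 ≤ max 0 z.1 := le_max_left _ _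
    have h2 : 0 ≤ max 0 z.2 := le_max_left _ _
    rw [log_beta (by linarith) (by linarith), max_eq_right (add_nonneg h1 h2)]
    ring_nf
  unfold betaDiv
  simp_rw [h]
  have c1 := continuous_log_Gamma_add_max hα (continuous_fst (X := ℝ) (Y := ℝ))
  have c2 := continuous_log_Gamma_add_max hβ (continuous_snd (X := ℝ) (Y := ℝ))
  have c3 := continuous_log_Gamma_add_max (add_pos hα hβ)
    (g := fun z : ℝ × ℝ => max 0 z.1 + max 0 z.2) (by fun_prop)
  fun_prop

namespace BayesNet

variable {I : Type*} (G : BayesNet I) {n : ℕ} (D : Fin n → I → Bool) (c : G.Cell)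

theorem updateA_add_updateB_le : G.updateA D c + G.updateB D c ≤ n := by
  rw [updateA, updateB, ← Finset.card_union_of_disjoint]
  · exact (Finset.card_le_univ _).trans_eq (Fintype.card_fin n)
  · rw [Finset.disjoint_left]
    intro t h1 h2
    rw [Finset.mem_filter] at h1 h2
    rw [h1.2.2] at h2
    exact Bool.noConfusion h2.2.2

theorem cast_updateA_mem : (G.updateA D c : ℝ) ∈ Set.Icc (0 : ℝ) n :=
  ⟨Nat.cast_nonneg _, by exact_mod_cast (Nat.le_add_right _ _).trans (G.updateA_add_updateB_le D c)⟩

theorem cast_updateB_mem : (G.updateB D c : ℝ) ∈ Set.Icc (0 : ℝ) n :=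
  ⟨Nat.cast_nonneg _, by exact_mod_cast (Nat.le_add_left _ _).trans (G.updateA_add_updateB_le D c)⟩

theorem release_mem {Ω : Type*} (N₁ N₂ : G.Cell → Ω → ℝ) (ω : Ω) :
    G.release D N₁ N₂ c ω ∈ Set.Icc (0 : ℝ) n ×ˢ Set.Icc (0 : ℝ) n :=
  ⟨⟨le_max_left _ _, max_le n.cast_nonneg (min_le_right _ _)⟩,
    ⟨le_max_left _ _, max_le n.cast_nonneg (min_le_right _ _)⟩⟩

variable {α β : G.Cell → ℝ}

theorem cellLoss_eq_betaDiv (hα : ∀ c, 2 ≤ α c) (hβ : ∀ c, 2 ≤ β c)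
    {z : ℝ × ℝ} (hz : z ∈ Set.Icc (0 : ℝ) n ×ˢ Set.Icc (0 : ℝ) n) :
    G.cellLoss α β D c z
      = betaDiv (α c + G.updateA D c) (β c + G.updateB D c) (α c + z.1) (β c + z.2) := by
  have h1 := hα c
  have h2 := hβ c
  have h3 := (G.cast_updateA_mem D c).1
  have h4 := (G.cast_updateB_mem D c).1
  exact toReal_klDiv_betaMeasure (by linarith) (by linarith) (by linarith [hz.1.1])
    (by linarith [hz.2.1])

theorem cellLoss_nonneg (α β : G.Cell → ℝ) (z : ℝ × ℝ) : 0 ≤ G.cellLoss α β D c z :=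
  ENNReal.toReal_nonneg

theorem cellLoss_le_log (hα : ∀ c, 2 ≤ α c) (hβ : ∀ c, 2 ≤ β c)
    {z : ℝ × ℝ} (hz : z ∈ Set.Icc (0 : ℝ) n ×ˢ Set.Icc (0 : ℝ) n) :
    G.cellLoss α β D c z ≤ n * (Real.log (α c + n) + Real.log (β c + n)) := by
  have h3 := G.cast_updateA_mem D c
  have h4 := G.cast_updateB_mem D c
  rw [G.cellLoss_eq_betaDiv D c hα hβ hz]
  refine betaDiv_le_log (hα c) (hβ c) n.cast_nonneg ?_ ?_ ?_ ?_
  · exact ⟨by linarith [h3.1], by linarith [h3.2]⟩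
  · exact ⟨by linarith [h4.1], by linarith [h4.2]⟩
  · exact ⟨by linarith [hz.1.1], by linarith [hz.1.2]⟩
  · exact ⟨by linarith [hz.2.1], by linarith [hz.2.2]⟩

theorem abs_cellLoss_sub_le (hα : ∀ c, 2 ≤ α c) (hβ : ∀ c, 2 ≤ β c)
    {z z' : ℝ × ℝ} (hz : z ∈ Set.Icc (0 : ℝ) n ×ˢ Set.Icc (0 : ℝ) n)
    (hz' : z' ∈ Set.Icc (0 : ℝ) n ×ˢ Set.Icc (0 : ℝ) n) :
    |G.cellLoss α β D c z - G.cellLoss α β D c z'|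
      ≤ (2 * n + 1) * Real.log ((α c + n + 1) + (β c + n + 1)) := by
  have hn : (0 : ℝ) ≤ n := n.cast_nonneg
  have h1 := hα c
  have h2 := hβ c
  have l1 : Real.log (α c + n) ≤ Real.log ((α c + n + 1) + (β c + n + 1)) :=
    Real.log_le_log (by linarith) (by linarith)
  have l2 : Real.log (β c + n) ≤ Real.log ((α c + n + 1) + (β c + n + 1)) :=
    Real.log_le_log (by linarith) (by linarith)
  have l3 : 0 ≤ Real.log ((α c + n + 1) + (β c + n + 1)) := Real.log_nonneg (by linarith)
  have l4 := mul_le_mul_of_nonneg_left (add_le_add l1 l2) hn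
  have p1 := G.cellLoss_nonneg D c α β z
  have p2 := G.cellLoss_nonneg D c α β z'
  have q1 := G.cellLoss_le_log D c hα hβ hz
  have q2 := G.cellLoss_le_log D c hα hβ hz'
  -- Both losses lie between `0` and the same upper bound, so `2 n` copies of the logarithm suffice;
  -- the remaining one is slack.
  rw [abs_le]
  constructor <;> linarith

/-- Some admissible output of the mechanism has positive loss. -/
theorem exists_cellLoss_ne (hα : ∀ c, 2 ≤ α c) (hβ : ∀ c, 2 ≤ β c)
    (hn : 1 ≤ n) : ∃ z ∈ Set.Icc (0 : ℝ) n ×ˢ Set.Icc (0 : ℝ) n,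
    ∃ z' ∈ Set.Icc (0 : ℝ) n ×ˢ Set.Icc (0 : ℝ) n,
      G.cellLoss α β D c z ≠ G.cellLoss α β D c z' := by
  by_contra! h
  have hn' : (1 : ℝ) ≤ n := by exact_mod_cast hn
  have h1 := hα c
  have h2 := hβ c
  have h3 := G.cast_updateA_mem D c
  have h4 := G.cast_updateB_mem D c
  have hself : G.cellLoss α β D c (G.updateA D c, G.updateB D c) = 0 := by
    rw [G.cellLoss_eq_betaDiv D c hα hβ ⟨h3, h4⟩]
    simp [betaDiv]
  have hz : ∀ r ∈ Set.Icc (0 : ℝ) n, α c + G.updateA D c = α c + r := fun r hr => by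
    refine eq_of_betaDiv_eq_zero (b := β c + G.updateB D c) (by linarith [h3.1])
      (by linarith [h4.1]) (by linarith [hr.1]) ?_
    rw [← G.cellLoss_eq_betaDiv D c hα hβ (z := (r, G.updateB D c)) ⟨hr, h4⟩, ← hself]
    exact h _ ⟨hr, h4⟩ _ ⟨h3, h4⟩
  -- As `n ≥ 1`, both `0` and `1` are admissible outputs, and they cannot both equal the true count.
  have e0 := hz 0 ⟨le_rfl, by linarith⟩
  have e1 := hz 1 ⟨zero_le_one, hn'⟩
  linarith

/-! ### Random releases -/

theorem cellLoss_release_eq_comp (hα : ∀ c, 2 ≤ α c) (hβ : ∀ c, 2 ≤ β c)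
    {Ω : Type*} (N₁ N₂ : G.Cell → Ω → ℝ) : (fun ω => G.cellLoss α β D c (G.release D N₁ N₂ c ω))
    = (fun z : ℝ × ℝ => betaDiv (α c + G.updateA D c) (β c + G.updateB D c)
        (α c + max 0 z.1) (β c + max 0 z.2)) ∘ G.release D N₁ N₂ c := by
  funext ω
  have h := G.release_mem D c N₁ N₂ ω
  rw [G.cellLoss_eq_betaDiv D c hα hβ h, Function.comp_apply, max_eq_right h.1.1,
    max_eq_right h.2.1]

theorem logGammaGap_clamp_le_signStep {α k : ℝ} (hα : 2 ≤ α) (hk : k ∈ Set.Icc (0 : ℝ) n)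
    {Ω : Type*} {N : Ω → ℝ} (ω : Ω) :
    logGammaGap (α + max 0 (min (k + N ω) n)) (α + k)
      ≤ signStep N (n * (realDigamma (α + n) - realDigamma (α + k)))
          (n * (realDigamma (α + k) - realDigamma α)) ω := by
  have hk0 := hk.1
  refine le_signStep_of_clamp (N := N) (g := fun r => logGammaGap (α + r) (α + k)) hk
    (logGammaGap_self _).le ?_ ?_ ω
  · intro r hr
    exact logGammaGap_le_of_le (by linarith) (by linarith [hr.1]) (by linarith [hr.2])
      (by linarith [hr.2])
  · intro r hr
    exact logGammaGap_le_of_ge (by linarith) (by linarith [hr.1]) (by linarith [hr.2])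
      (by linarith [hr.1, hk.2])

section Release

variable {Ω : Type*} [MeasurableSpace Ω] {P : Measure Ω} {N₁ N₂ : G.Cell → Ω → ℝ} {b : ℝ}

theorem measurable_release (h1 : Measurable (N₁ c)) (h2 : Measurable (N₂ c)) :
    Measurable (G.release D N₁ N₂ c) := by
  unfold release
  fun_prop

theorem measurable_cellLoss_release (hα : ∀ c, 2 ≤ α c) (hβ : ∀ c, 2 ≤ β c)
    (h1 : Measurable (N₁ c)) (h2 : Measurable (N₂ c)) :
    Measurable fun ω => G.cellLoss α β D c (G.release D N₁ N₂ c ω) := by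
  have ha := hα c
  have hb := hβ c
  rw [G.cellLoss_release_eq_comp D c hα hβ N₁ N₂]
  exact (continuous_betaDiv_max (by linarith) (by linarith) _ _).measurable.comp
    (G.measurable_release D c h1 h2)

theorem iIndepFun_cellLoss_release (hα : ∀ c, 2 ≤ α c) (hβ : ∀ c, 2 ≤ β c)
    (h : iIndepFun (fun c => G.release D N₁ N₂ c) P) :
    iIndepFun (fun c ω => G.cellLoss α β D c (G.release D N₁ N₂ c ω)) P := by
  have h' := h.comp (fun c (z : ℝ × ℝ) => betaDiv (α c + G.updateA D c) (β c + G.updateB D c)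
        (α c + max 0 z.1) (β c + max 0 z.2)) fun c => by
    have ha := hα c
    have hb := hβ c
    exact (continuous_betaDiv_max (by linarith) (by linarith) _ _).measurable
  convert h' using 1
  exact funext fun c => G.cellLoss_release_eq_comp D c hα hβ N₁ N₂

variable [IsProbabilityMeasure P]

theorem integrable_cellLoss_release (hα : ∀ c, 2 ≤ α c) (hβ : ∀ c, 2 ≤ β c)
    (h1 : Measurable (N₁ c)) (h2 : Measurable (N₂ c)) :
    Integrable (fun ω => G.cellLoss α β D c (G.release D N₁ N₂ c ω)) P :=
  Integrable.of_mem_Icc 0 (n * (Real.log (α c + n) + Real.log (β c + n)))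
    (G.measurable_cellLoss_release D c hα hβ h1 h2).aemeasurable
    (ae_of_all _ fun ω => ⟨G.cellLoss_nonneg D c α β _,
      G.cellLoss_le_log D c hα hβ (G.release_mem D c N₁ N₂ ω)⟩)

/-- By linearity of expectation, the joint law of the two noises within a cell plays no role. -/
theorem integral_cellLoss_release_le_half (hα : ∀ c, 2 ≤ α c) (hβ : ∀ c, 2 ≤ β c)
    (h1 : Measurable (N₁ c)) (h2 : Measurable (N₂ c))
    (l1 : P.map (N₁ c) = laplaceMeasure b) (l2 : P.map (N₂ c) = laplaceMeasure b)
    {x₁ y₁ x₂ y₂ : ℝ} (hx₁ : 0 ≤ x₁) (hy₁ : 0 ≤ y₁) (hx₂ : 0 ≤ x₂) (hy₂ : 0 ≤ y₂)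
    (h : ∀ ω, G.cellLoss α β D c (G.release D N₁ N₂ c ω)
      ≤ signStep (N₁ c) x₁ y₁ ω + signStep (N₂ c) x₂ y₂ ω) :
    ∫ ω, G.cellLoss α β D c (G.release D N₁ N₂ c ω) ∂P ≤ (x₁ + y₁ + (x₂ + y₂)) / 2 := by
  have i1 := integrable_signStep (P := P) h1 x₁ y₁
  have i2 := integrable_signStep (P := P) h2 x₂ y₂
  refine (integral_mono (G.integrable_cellLoss_release D c hα hβ h1 h2) (i1.add i2) h).trans ?_
  simp only [Pi.add_apply]
  rw [integral_add i1 i2]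
  have := integral_signStep_le h1 l1 hx₁ hy₁
  have := integral_signStep_le h2 l2 hx₂ hy₂
  linarith

/-- The bound on the expected loss that holds for every scale of the noise. -/
theorem integral_cellLoss_release_le (hα : ∀ c, 2 ≤ α c) (hβ : ∀ c, 2 ≤ β c)
    (h1 : Measurable (N₁ c)) (h2 : Measurable (N₂ c))
    (l1 : P.map (N₁ c) = laplaceMeasure b) (l2 : P.map (N₂ c) = laplaceMeasure b) :
    ∫ ω, G.cellLoss α β D c (G.release D N₁ N₂ c ω) ∂P
      ≤ n * Real.log ((α c + G.updateA D c) * (β c + G.updateB D c)) := by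
  have hA := hα c
  have hB := hβ c
  have hk := G.cast_updateA_mem D c
  have hl := G.cast_updateB_mem D c
  have hkl : (G.updateA D c : ℝ) + G.updateB D c ≤ n := by
    exact_mod_cast G.updateA_add_updateB_le D c
  set k : ℝ := ((G.updateA D c : ℕ) : ℝ)
  set l : ℝ := ((G.updateB D c : ℕ) : ℝ)
  have hk0 := hk.1
  have hl0 := hl.1
  have p1 := realDigamma_mono (x := α c + k) (y := α c + k + (β c + l)) (by linarith) (by linarith)
  have p2 := realDigamma_mono (x := β c + l) (y := α c + k + (β c + l)) (by linarith) (by linarith)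
  have p3 := realDigamma_mono (x := α c) (y := α c + k) (by linarith) (by linarith)
  have p4 := realDigamma_mono (x := β c) (y := β c + l) (by linarith) (by linarith)
  -- Above the count the cost is linear over a range of length `n - k`; a gap estimate there would
  -- bring in `ψ(α + n)`, which the true counts do not control. Below it a gap over length `k` is
  -- used.
  have key := G.integral_cellLoss_release_le_half D c hα hβ h1 h2 l1 l2
    (x₁ := (n - k) * (realDigamma (α c + k + (β c + l)) - realDigamma (α c + k)))
    (y₁ := k * (realDigamma (α c + k) - realDigamma (α c)))
    (x₂ := (n - l) * (realDigamma (α c + k + (β c + l)) - realDigamma (β c + l)))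
    (y₂ := l * (realDigamma (β c + l) - realDigamma (β c)))
    (mul_nonneg (by linarith [hk.2]) (by linarith)) (mul_nonneg hk0 (by linarith))
    (mul_nonneg (by linarith [hl.2]) (by linarith)) (mul_nonneg hl0 (by linarith)) ?_
  · have := worst_case_sum_le hA hB hk0 hl0 hkl rfl rfl
    linarith
  · intro ω
    have hz := G.release_mem D c N₁ N₂ ω
    rw [G.cellLoss_eq_betaDiv D c hα hβ hz]
    refine (betaDiv_le_max_add_gap_min (by linarith) (by linarith) (by linarith [hz.1.1])
      (by linarith [hz.2.1])).trans (add_le_add ?_ ?_)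
    · refine le_signStep_of_clamp (N := N₁ c) (g := fun r => max 0 (α c + r - (α c + k))
        * (realDigamma (α c + k + (β c + l)) - realDigamma (α c + k))
        + logGammaGap (min (α c + r) (α c + k)) (α c + k)) hk (by simp [logGammaGap_self]) ?_ ?_ ω
      · intro r hr
        rw [min_eq_right (by linarith [hr.1]), logGammaGap_self, add_zero]
        exact mul_le_mul_of_nonneg_right (max_le (by linarith [hk.2]) (by linarith [hr.2]))
          (by linarith)
      · intro r hr
        rw [min_eq_left (by linarith [hr.2]), max_eq_left (by linarith [hr.2]), zero_mul, zero_add]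
        exact logGammaGap_le_of_ge (by linarith) (by linarith [hr.1]) (by linarith [hr.2])
          (by linarith [hr.1])
    · refine le_signStep_of_clamp (N := N₂ c) (g := fun r => max 0 (β c + r - (β c + l))
        * (realDigamma (α c + k + (β c + l)) - realDigamma (β c + l))
        + logGammaGap (min (β c + r) (β c + l)) (β c + l)) hl (by simp [logGammaGap_self]) ?_ ?_ ω
      · intro r hr
        rw [min_eq_right (by linarith [hr.1]), logGammaGap_self, add_zero]
        exact mul_le_mul_of_nonneg_right (max_le (by linarith [hl.2]) (by linarith [hr.2]))
          (by linarith)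
      · intro r hr
        rw [min_eq_left (by linarith [hr.2]), max_eq_left (by linarith [hr.2]), zero_mul, zero_add]
        exact logGammaGap_le_of_ge (by linarith) (by linarith [hr.1]) (by linarith [hr.2])
          (by linarith [hr.1])

/-- The expected loss is at most half of the worst-case bound. -/
theorem integral_cellLoss_release_le_half_log (hα : ∀ c, 2 ≤ α c) (hβ : ∀ c, 2 ≤ β c)
    (h1 : Measurable (N₁ c)) (h2 : Measurable (N₂ c))
    (l1 : P.map (N₁ c) = laplaceMeasure b) (l2 : P.map (N₂ c) = laplaceMeasure b) :
    ∫ ω, G.cellLoss α β D c (G.release D N₁ N₂ c ω) ∂P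
      ≤ n * Real.log ((α c + n + 1) * (β c + n + 1)) * (1 / 2) := by
  have hA := hα c
  have hB := hβ c
  have hk := G.cast_updateA_mem D c
  have hl := G.cast_updateB_mem D c
  set k : ℝ := ((G.updateA D c : ℕ) : ℝ)
  set l : ℝ := ((G.updateB D c : ℕ) : ℝ)
  have hk0 := hk.1
  have hl0 := hl.1
  have hkn := hk.2
  have hln := hl.2
  have hn : (0 : ℝ) ≤ n := n.cast_nonneg
  have p1 := realDigamma_mono (x := α c + k) (y := α c + n) (by linarith) (by linarith)
  have p2 := realDigamma_mono (x := α c) (y := α c + k) (by linarith) (by linarith)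
  have p3 := realDigamma_mono (x := β c + l) (y := β c + n) (by linarith) (by linarith)
  have p4 := realDigamma_mono (x := β c) (y := β c + l) (by linarith) (by linarith)
  -- The heights above and below the count share the factor `n`, so their sum telescopes to `n (ψ(α
  -- + n) - ψ(α))`, and likewise for `β`.
  have key := G.integral_cellLoss_release_le_half D c hα hβ h1 h2 l1 l2
    (mul_nonneg hn (sub_nonneg.2 p1)) (mul_nonneg hn (sub_nonneg.2 p2))
    (mul_nonneg hn (sub_nonneg.2 p3)) (mul_nonneg hn (sub_nonneg.2 p4)) ?_
  · have e1 := (realDigamma_le_log (by linarith : 0 < α c + n)).trans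
      (Real.log_le_log (by linarith) (by linarith : α c + n ≤ α c + n + 1))
    have e2 := (realDigamma_le_log (by linarith : 0 < β c + n)).trans
      (Real.log_le_log (by linarith) (by linarith : β c + n ≤ β c + n + 1))
    have e3 := realDigamma_nonneg hA
    have e4 := realDigamma_nonneg hB
    have e5 : n * (realDigamma (α c + n) - realDigamma (α c)
        + (realDigamma (β c + n) - realDigamma (β c)))
        ≤ n * (Real.log (α c + n + 1) + Real.log (β c + n + 1)) :=
      mul_le_mul_of_nonneg_left (by linarith) hn
    rw [Real.log_mul (by linarith) (by linarith)]
    linarith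
  · intro ω
    have hz := G.release_mem D c N₁ N₂ ω
    rw [G.cellLoss_eq_betaDiv D c hα hβ hz]
    refine (betaDiv_le_gap_add_gap (by linarith) (by linarith) (by linarith [hz.1.1])
      (by linarith [hz.2.1])).trans (add_le_add ?_ ?_)
    · exact logGammaGap_clamp_le_signStep hA hk ω
    · exact logGammaGap_clamp_le_signStep hB hl ω

end Release

/-! ### The joint posteriors -/

section Joint

variable [Fintype I] [DecidableEq I]

theorem klDiv_posterior_eq_ofReal_sumLoss (hα : ∀ c, 2 ≤ α c) (hβ : ∀ c, 2 ≤ β c)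
    {z : G.Cell → ℝ × ℝ}
    (hz : ∀ c, z c ∈ Set.Icc (0 : ℝ) n ×ˢ Set.Icc (0 : ℝ) n) :
    klDiv (G.posterior α β D) (G.privatePosterior α β z)
      = ENNReal.ofReal (G.sumLoss α β D z) := by
  have a0 : ∀ c, 0 < α c + G.updateA D c := fun c => by
    linarith [hα c, (G.cast_updateA_mem D c).1]
  have b0 : ∀ c, 0 < β c + G.updateB D c := fun c => by
    linarith [hβ c, (G.cast_updateB_mem D c).1]
  have a1 : ∀ c, 0 < α c + (z c).1 := fun c => by linarith [hα c, (hz c).1.1]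
  have b1 : ∀ c, 0 < β c + (z c).2 := fun c => by linarith [hβ c, (hz c).2.1]
  have i1 : ∀ c, IsProbabilityMeasure (G.cellPosterior α β D c) := fun c =>
    isProbabilityMeasureBeta (a0 c) (b0 c)
  have i2 : ∀ c, IsProbabilityMeasure (G.cellPrivate α β c (z c)) := fun c =>
    isProbabilityMeasureBeta (a1 c) (b1 c)
  exact klDiv_pi (fun c => betaMeasure_ac (a0 c) (b0 c) (a1 c) (b1 c))
    fun c => integrable_llr_betaMeasure (a0 c) (b0 c) (a1 c) (b1 c)

theorem card_cell : Fintype.card G.Cell = G.size := by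
  simp [size]

theorem measure_sumLoss_release_ge_le (hα : ∀ c, 2 ≤ α c) (hβ : ∀ c, 2 ≤ β c)
    [Nonempty I] {Ω : Type*} [MeasurableSpace Ω] {P : Measure Ω}
    [IsProbabilityMeasure P] {N₁ N₂ : G.Cell → Ω → ℝ} {ε : ℝ} (hn : 1 ≤ n)
    (hrun : G.IsRun D ε P N₁ N₂) {b : G.Cell → ℝ}
    (hb : ∀ c, ∀ z ∈ Set.Icc (0 : ℝ) n ×ˢ Set.Icc (0 : ℝ) n,
      ∀ z' ∈ Set.Icc (0 : ℝ) n ×ˢ Set.Icc (0 : ℝ) n,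
        |G.cellLoss α β D c z - G.cellLoss α β D c z'| ≤ b c)
    {δ : ℝ} (hδ : 0 < δ) (hδ1 : δ ≤ 1) :
    P {ω | (∫ ω', G.sumLoss α β D (fun c => G.release D N₁ N₂ c ω') ∂P)
          + Real.sqrt (-(1 / 2) * (∑ c, b c ^ 2) * Real.log δ)
        ≤ G.sumLoss α β D (fun c => G.release D N₁ N₂ c ω)} ≤ ENNReal.ofReal δ := by
  -- Hoeffding's inequality needs nondegenerate ranges; a nonconstant loss forces every admissible
  -- constant to be positive.
  have hpos : ∀ c, 0 < b c := fun c => by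
    obtain ⟨z, hz, z', hz', hne⟩ := G.exists_cellLoss_ne D c hα hβ hn
    exact (abs_pos.2 (sub_ne_zero.2 hne)).trans_le (hb c z hz z' hz')
  have hcell : Nonempty G.Cell := ⟨⟨Classical.arbitrary I, fun _ => true⟩⟩
  refine measure_sum_ge_le_of_bounded_differences
    -- An oscillation of at most `b c` places the loss between its infimum over the box and that
    -- infimum plus `b c`.
    (m := fun c => sInf (G.cellLoss α β D c '' (Set.Icc (0 : ℝ) n ×ˢ Set.Icc (0 : ℝ) n)))
    (fun c => G.measurable_cellLoss_release D c hα hβ (hrun.measurable₁ c) (hrun.measurable₂ c))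
    (G.iIndepFun_cellLoss_release D hα hβ hrun.indep) ?_
    (Finset.sum_pos (fun c _ => pow_pos (hpos c) 2) Finset.univ_nonempty) hδ hδ1
  intro c ω
  have hz := G.release_mem D c N₁ N₂ ω
  constructor
  · refine csInf_le ⟨0, ?_⟩ ⟨_, hz, rfl⟩
    rintro _ ⟨z, -, rfl⟩
    exact G.cellLoss_nonneg D c α β z
  · rw [← sub_le_iff_le_add]
    refine le_csInf ⟨_, _, hz, rfl⟩ ?_
    rintro _ ⟨z, hz', rfl⟩
    linarith [(le_abs_self _).trans (hb c _ hz z hz')]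

/-- With bounded priors the total loss is of order `m n log n`. -/
theorem sumLoss_le_log (hα : ∀ c, 2 ≤ α c) (hβ : ∀ c, 2 ≤ β c)
    {A : ℝ} (hαA : ∀ c, α c ≤ A) (hβA : ∀ c, β c ≤ A) (hn : 2 ≤ n)
    {z : G.Cell → ℝ × ℝ} (hz : ∀ c, z c ∈ Set.Icc (0 : ℝ) n ×ˢ Set.Icc (0 : ℝ) n) :
    G.sumLoss α β D z
      ≤ 2 * (1 + Real.log (1 + |A|) / Real.log 2) * (G.size * n * Real.log n) := by
  have hn' : (2 : ℝ) ≤ n := by exact_mod_cast hn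
  have hA0 : 0 ≤ |A| := abs_nonneg A
  have hlogA : 0 ≤ Real.log (1 + |A|) := Real.log_nonneg (by linarith)
  have hlog2 : 0 < Real.log 2 := Real.log_pos (by norm_num)
  have hlogn : Real.log 2 ≤ Real.log n := Real.log_le_log (by norm_num) hn'
  have hlog : ∀ x : ℝ, 2 ≤ x → x ≤ A →
      Real.log (x + n) ≤ (1 + Real.log (1 + |A|) / Real.log 2) * Real.log n := fun x h2 hx => by
    have hxn : x + n ≤ (1 + |A|) * n := by nlinarith [le_abs_self A]
    have h := Real.log_le_log (by linarith) hxn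
    rw [Real.log_mul (by linarith) (by linarith)] at h
    -- Since `n ≥ 2`, the constant `log (1 + |A|)` is absorbed into a multiple of `log n`.
    have : Real.log (1 + |A|) ≤ Real.log (1 + |A|) / Real.log 2 * Real.log n := by
      rw [div_mul_eq_mul_div, le_div_iff₀ hlog2]
      exact mul_le_mul_of_nonneg_left hlogn hlogA
    linarith
  have hc : ∀ c ∈ Finset.univ, G.cellLoss α β D c (z c)
      ≤ n * (2 * ((1 + Real.log (1 + |A|) / Real.log 2) * Real.log n)) := fun c _ => by
    refine (G.cellLoss_le_log D c hα hβ (hz c)).trans (mul_le_mul_of_nonneg_left ?_ n.cast_nonneg)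
    linarith [hlog _ (hα c) (hαA c), hlog _ (hβ c) (hβA c)]
  refine (Finset.sum_le_card_nsmul _ _ _ hc).trans_eq ?_
  rw [Finset.card_univ, card_cell, nsmul_eq_mul]
  ring

end Joint

end BayesNet

/-- When the scale `b` of the noise is at most `max n s`, the factor `1 - exp (-n / b)` is bounded
below in terms of `s`. -/
theorem one_sub_exp_le_of_le_max {n s k ε : ℝ} (hn : 1 ≤ n) (hk : 0 < k) (hε : 0 < ε)
    (h : k / ε ≤ max n s) :
    1 - Real.exp (-(1 / max 1 s)) ≤ 1 - Real.exp (-(n * ε / k)) := by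
  have hs : 1 ≤ max 1 s := le_max_left _ _
  -- Hence `b ≤ n * max 1 s`, that is, `n / b ≥ 1 / max 1 s`.
  have hmax : max n s ≤ n * max 1 s :=
    max_le (le_mul_of_one_le_right (by linarith) hs) ((le_max_right 1 s).trans
      (le_mul_of_one_le_left (by linarith) hn))
  have : 1 / max 1 s ≤ n * ε / k := by
    rw [div_le_div_iff₀ (by linarith) hk]
    have := (div_le_iff₀ hε).1 (h.trans hmax)
    linarith
  have := Real.exp_le_exp.2 (neg_le_neg this)
  linarith

theorem mainTheorem2 :
    -- the concentration inequality, with its constants and the bounds on the expectations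
    (∀ (I : Type*) [Fintype I] [DecidableEq I] [Nonempty I] (G : BayesNet I) (n : ℕ), 1 ≤ n →
      ∀ (D : Fin n → I → Bool) (ε : ℝ), 0 < ε →
      ∀ α β : G.Cell → ℝ, (∀ c, 2 ≤ α c) → (∀ c, 2 ≤ β c) →
      ∀ (Ω : Type*) [MeasurableSpace Ω] (P : Measure Ω) [IsProbabilityMeasure P]
        (N₁ N₂ : G.Cell → Ω → ℝ), G.IsRun D ε P N₁ N₂ →
      -- the divergence of the joint posteriors is the sum of the divergences of the cells
      (∀ z : G.Cell → ℝ × ℝ, (∀ c, z c ∈ Set.Icc (0 : ℝ) n ×ˢ Set.Icc (0 : ℝ) n) →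
        klDiv (G.posterior α β D) (G.privatePosterior α β z)
          = ENNReal.ofReal (G.sumLoss α β D z)) ∧
      -- the tail bound, for any constants of bounded differences
      (∀ b : G.Cell → ℝ,
        (∀ c, ∀ z ∈ Set.Icc (0 : ℝ) n ×ˢ Set.Icc (0 : ℝ) n,
          ∀ z' ∈ Set.Icc (0 : ℝ) n ×ˢ Set.Icc (0 : ℝ) n,
            |G.cellLoss α β D c z - G.cellLoss α β D c z'| ≤ b c) →
        ∀ δ : ℝ, 0 < δ → δ ≤ 1 →
          P {ω | (∫ ω', G.sumLoss α β D (fun c => G.release D N₁ N₂ c ω') ∂P)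
                  + Real.sqrt (-(1 / 2) * (∑ c, b c ^ 2) * Real.log δ)
                ≤ G.sumLoss α β D (fun c => G.release D N₁ N₂ c ω)}
            ≤ ENNReal.ofReal δ) ∧
      -- admissible constants
      (∀ c, ∀ z ∈ Set.Icc (0 : ℝ) n ×ˢ Set.Icc (0 : ℝ) n,
        ∀ z' ∈ Set.Icc (0 : ℝ) n ×ˢ Set.Icc (0 : ℝ) n,
          |G.cellLoss α β D c z - G.cellLoss α β D c z'|
            ≤ (2 * n + 1) * Real.log ((α c + n + 1) + (β c + n + 1))) ∧
      -- the expectation in each cell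
      (∀ c, Integrable (fun ω => G.cellLoss α β D c (G.release D N₁ N₂ c ω)) P ∧
        ∫ ω, G.cellLoss α β D c (G.release D N₁ N₂ c ω) ∂P
          ≤ n * Real.log ((α c + G.updateA D c) * (β c + G.updateB D c))) ∧
      -- the refined bound on the expectation
      (2 * Fintype.card I / ε ≤ n → ∀ c,
        ∫ ω, G.cellLoss α β D c (G.release D N₁ N₂ c ω) ∂P
          ≤ n * Real.log ((α c + n + 1) * (β c + n + 1))
              * (1 - Real.exp (-(n * ε / (2 * Fintype.card I)))))) ∧
    -- the loss of utility, with a constant that depends on nothing but `A` and `s`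
    (∀ A s : ℝ, ∃ C : ℝ, 0 < C ∧
      ∀ (I : Type*) [Fintype I] [DecidableEq I] [Nonempty I] (G : BayesNet I) (n : ℕ), 2 ≤ n →
      ∀ (D : Fin n → I → Bool) (ε : ℝ), 0 < ε → 2 * Fintype.card I / ε ≤ max (n : ℝ) s →
      ∀ α β : G.Cell → ℝ, (∀ c, 2 ≤ α c ∧ α c ≤ A) → (∀ c, 2 ≤ β c ∧ β c ≤ A) →
      ∀ (Ω : Type*) [MeasurableSpace Ω] (P : Measure Ω) [IsProbabilityMeasure P]
        (N₁ N₂ : G.Cell → Ω → ℝ), G.IsRun D ε P N₁ N₂ →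
      ∀ δ : ℝ, 0 < δ → δ ≤ 1 →
        ENNReal.ofReal (1 - δ) ≤
          P {ω | klDiv (G.posterior α β D)
                  (G.privatePosterior α β (fun c => G.release D N₁ N₂ c ω))
                ≤ ENNReal.ofReal
                  (C * (G.size * n * Real.log n)
                      * (1 - Real.exp (-(n * ε / (2 * Fintype.card I))))
                    + Real.sqrt (-(C * (G.size * n * Real.log n)) * Real.log δ))}) := by
  refine ⟨?_, ?_⟩
  · intro I _ _ _ G n hn D ε hε α β hα hβ Ω _ P _ N₁ N₂ hrun
    refine ⟨fun z hz => G.klDiv_posterior_eq_ofReal_sumLoss D hα hβ hz,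
      fun b hb δ hδ hδ1 => G.measure_sumLoss_release_ge_le D hα hβ hn hrun hb hδ hδ1,
      fun c z hz z' hz' => G.abs_cellLoss_sub_le D c hα hβ hz hz',
      fun c => ⟨G.integrable_cellLoss_release D c hα hβ (hrun.measurable₁ c) (hrun.measurable₂ c),
        G.integral_cellLoss_release_le D c hα hβ (hrun.measurable₁ c) (hrun.measurable₂ c)
          (hrun.law₁ c) (hrun.law₂ c)⟩, fun hbn c => ?_⟩
    refine (G.integral_cellLoss_release_le_half_log D c hα hβ (hrun.measurable₁ c)
      (hrun.measurable₂ c) (hrun.law₁ c) (hrun.law₂ c)).trans (mul_le_mul_of_nonneg_left ?_ ?_)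
    · have hI : (0 : ℝ) < 2 * Fintype.card I := by
        have : 0 < Fintype.card I := Fintype.card_pos
        positivity
      -- With `s = 1` the factor is at least `1 - 1/e`, which exceeds `1/2` because `e > 2`.
      have h := one_sub_exp_le_of_le_max (n := n) (s := 1) (by exact_mod_cast hn) hI hε
        (hbn.trans (le_max_left _ _))
      have he := Real.exp_one_gt_d9
      rw [max_self, div_one, Real.exp_neg] at h
      have := inv_anti₀ (by norm_num : (0 : ℝ) < 2) (by linarith : (2 : ℝ) ≤ Real.exp 1)
      linarith
    · have h1 := hα c
      have h2 := hβ c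
      have h3 : (0 : ℝ) ≤ n := n.cast_nonneg
      exact mul_nonneg h3 (Real.log_nonneg (by nlinarith))
  · intro A s
    have hκ : 0 < 1 - Real.exp (-(1 / max 1 s)) := by
      have : 0 < 1 / max 1 s := one_div_pos.2 (zero_lt_one.trans_le (le_max_left _ _))
      have := Real.exp_lt_one_iff.2 (neg_lt_zero.2 this)
      linarith
    have hK : 0 < 2 * (1 + Real.log (1 + |A|) / Real.log 2) := by
      have : 0 ≤ Real.log (1 + |A|) := Real.log_nonneg (by linarith [abs_nonneg A])
      have : 0 < Real.log 2 := Real.log_pos (by norm_num)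
      positivity
    -- The constant of the sure bound on the loss is divided by the least possible value of `1 -
    -- exp(-n/b)`.
    refine ⟨2 * (1 + Real.log (1 + |A|) / Real.log 2) / (1 - Real.exp (-(1 / max 1 s))),
      div_pos hK hκ, ?_⟩
    intro I _ _ _ G n hn D ε hε hb α β hα hβ Ω _ P _ N₁ N₂ hrun δ hδ hδ1
    have hn' : (1 : ℝ) ≤ n := by exact_mod_cast (by omega : 1 ≤ n)
    have hI : (0 : ℝ) < 2 * Fintype.card I := by
      have : 0 < Fintype.card I := Fintype.card_pos
      positivity
    have hx : (0 : ℝ) ≤ G.size * n * Real.log n :=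
      mul_nonneg (by positivity) (Real.log_nonneg hn')
    have hfac := one_sub_exp_le_of_le_max hn' hI hε hb
    set K := 2 * (1 + Real.log (1 + |A|) / Real.log 2)
    set κ := 1 - Real.exp (-(1 / max 1 s))
    have hmain : K * (G.size * n * Real.log n) ≤ K / κ * (G.size * n * Real.log n)
        * (1 - Real.exp (-(n * ε / (2 * Fintype.card I)))) := by
      refine le_trans (le_of_eq ?_)
        (mul_le_mul_of_nonneg_left hfac (mul_nonneg (div_pos hK hκ).le hx))
      field_simp
    -- The bound holds for every outcome, with the square root contributing only its nonnegativity;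
    -- the event therefore has probability one.
    have huniv : ∀ ω, klDiv (G.posterior α β D)
        (G.privatePosterior α β (fun c => G.release D N₁ N₂ c ω)) ≤ ENNReal.ofReal
          (K / κ * (G.size * n * Real.log n) * (1 - Real.exp (-(n * ε / (2 * Fintype.card I))))
            + Real.sqrt (-(K / κ * (G.size * n * Real.log n)) * Real.log δ)) := fun ω => by
      have hz := fun c => G.release_mem D c N₁ N₂ ω
      rw [G.klDiv_posterior_eq_ofReal_sumLoss D (fun c => (hα c).1) (fun c => (hβ c).1) hz]
      refine ENNReal.ofReal_le_ofReal (le_add_of_le_of_nonneg ?_ (Real.sqrt_nonneg _))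
      exact (G.sumLoss_le_log D (fun c => (hα c).1) (fun c => (hβ c).1) (fun c => (hα c).2)
        (fun c => (hβ c).2) hn hz).trans hmain
    refine le_trans ?_ (congrArg P (Set.eq_univ_of_forall huniv)).ge
    rw [measure_univ]
    exact ENNReal.ofReal_le_one.2 (by linarith)
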